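/- Let $\gamma\in[0,1]$ and $0<\alpha<\tfrac12$. Consider the selfish mining decision problem with states $(a,h,\mathrm{fork})$, $a,h\in\mathbb N$, $\mathrm{fork}\in\{\mathrm{irrelevant},\mathrm{relevant},\mathrm{active}\}$, in which every step is the creation of one block, by the attacker with probability $\alpha$ and by the honest network with probability $1-\alpha$. The initial state $X_0$ is $(1,0,\mathrm{irrelevant})$ with probability $\alpha$ and $(0,1,\mathrm{irrelevant})$ with probability $1-\alpha$. The actions, with their rewards in $\mathbb N^2$ (accepted blocks of the attacker, accepted blocks of the honest network), are: - adopt (always feasible): reward $(0,h)$; the next state is distributed as $X_0$; - override (feasible iff $a>h$): reward $(h+1,0)$; the next state is $(a-h,0,\mathrm{irrelevant})$ with probability $\alpha$ and $(a-h-1,1,\mathrm{relevant})$ with probability $1-\alpha$; - wait in a state whose label is not active: reward $(0,0)$; the next state is $(a+1,h,\mathrm{irrelevant})$ with probability $\alpha$ and $(a,h+1,\mathrm{relevant})$ with probability $1-\alpha$; - match (feasible iff $a\ge h$ and the label is relevant), and wait in a state whose label is active: the next state is $(a+1,h,\mathrm{active})$ with probability $\alpha$ and reward $(0,0)$, $(a-h,1,\mathrm{relevant})$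 with probability $\gamma(1-\alpha)$ and reward $(h,0)$, $(a,h+1,\mathrm{relevant})$ with probability $(1-\gamma)(1-\alpha)$ and reward $(0,0)$. A policy $\pi$ assigns a feasible action to each state; it is admissible if at every time the expected time until the next action other than wait is finite. With $r_t=(r^1_t,r^2_t)$ the reward of the transition from $X_t$ to $X_{t+1}$, put $$\mathrm{REV}(\pi,\alpha,\gamma)=\mathbb E\Big[\liminf_{N\to\infty}\frac{\sum_{t=1}^N r^1_t}{\sum_{t=1}^N(r^1_t+r^2_t)}\Big].$$ Honest mining is the policy that adopts if $h>a$, overrides if $a>h$ and waits if $a=h$. The profit threshold is $$\hat\alpha(\gamma)=\inf\{\alpha'\in[0,1]:\ \mathrm{REV}(\pi,\alpha',\gamma)>\mathrm{REV}(\text{honest mining},\alpha',\gamma)\text{ for some admissible }\pi\}.$$ Let $T\ge2$ be an integer. The over-paying MDP $N^T_\alpha$ has the same states, actions and transitions, except that adopt is the only action allowed in states with $\max\{a,h\}=T$. Its immediate reward is $(1-\alpha)r^1-\alpha r^2$ in states with $\max\{a,h\}\ne T$. In states with $\max\{a,h\}=T$ it is $$(1-\alpha)\frac{\alpha(1-\alpha)}{(1-2\alpha)^2}+\frac12\Big(\frac{a-h}{1-2\alpha}+a+h\Big)\quad\text{if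 } T=a\ge h,$$ $$\Big(1-\big(\tfrac{\alpha}{1-\alpha}\big)^{h-a}\Big)(-\alpha h)+\big(\tfrac{\alpha}{1-\alpha}\big)^{h-a}(1-\alpha)\Big(\frac{\alpha(1-\alpha)}{(1-2\alpha)^2}+\frac{h-a}{1-2\alpha}\Big)\quad\text{if } T=h>a.$$ The value of a policy in it is the expectation of the $\liminf$ of the time average of the immediate rewards, and the optimal value is the supremum over all policies. Let $u_1^*$ be the optimal value of $N^T_\alpha$ when override is removed from the feasible actions in the states $(1,0,\cdot)$, and $u_2^*$ its optimal value when, instead, adopt is removed from the feasible actions in the states $(0,1,\cdot)$. Let $\varepsilon>0$, and let $u_1,u_2$ be real numbers with $|u_1-u_1^*|<\varepsilon$ and $|u_2-u_2^*|<\varepsilon$. If $u_1\le-\varepsilon$ and $u_2\le-\varepsilon$, then honest mining is optimal at $\alpha$, that is, it is admissible and $\mathrm{REV}(\pi,\alpha,\gamma)\le\mathrm{REV}(\text{honest mining},\alpha,\gamma)$ for every admissible policy $\pi$; moreover $\hat\alpha(\gamma)\ge\alpha$. -/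

import Mathlib

open MeasureTheory Filter

namespace SelfishMining

/-- The `fork` label of a state. -/
inductive Fork
  | irrelevant
  | relevant
  | active

/-- A state `(a, h, fork)`: lengths of the attacker's secret chain and of the honest chain
since the latest fork, together with the fork label. -/
structure State where
  a : ℕ
  h : ℕ
  fork : Fork

/-- The attacker's actions; `matching` is the action called "match". -/
inductive Action
  | adopt
  | override
  | matching
  | wait

/-- The creator of the next block: the attacker, an honest miner that extends the honest
network's own branch, or an honest miner that received the attacker's published branch first
(the last two are told apart only while the network is split). -/
inductive Block
  | attacker
  | honestOwn
  | honestSplit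

instance : MeasurableSpace Block := ⊤

/-- Feasibility of an action in a state. -/
def Feasible (s : State) : Action → Prop
  | .adopt => True
  | .override => s.h < s.a
  | .matching => s.h ≤ s.a ∧ s.fork = .relevant
  | .wait => True

/-- The state reached from an empty fork by the next block: `X₀`, and the state after `adopt`. -/
def initial : Block → State
  | .attacker => ⟨1, 0, .irrelevant⟩
  | _ => ⟨0, 1, .irrelevant⟩

/-- Next state when the honest network is not split and the attacker keeps its chain secret. -/
def extend (s : State) : Block → State
  | .attacker => ⟨s.a + 1, s.h, .irrelevant⟩
  | _ => ⟨s.a, s.h + 1, .relevant⟩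

/-- Next state when the honest network is split between the two branches. -/
def race (s : State) : Block → State
  | .attacker => ⟨s.a + 1, s.h, .active⟩
  | .honestSplit => ⟨s.a - s.h, 1, .relevant⟩
  | .honestOwn => ⟨s.a, s.h + 1, .relevant⟩

/-- Rewards (attacker, honest network) of a step in which the honest network is split. -/
def raceReward (s : State) : Block → ℕ × ℕ
  | .honestSplit => (s.h, 0)
  | _ => (0, 0)

/-- The transition function: next state, given the action and the creator of the next block. -/
def step (s : State) : Action → Block → State
  | .adopt, b => initial b
  | .override, .attacker => ⟨s.a - s.h, 0, .irrelevant⟩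
  | .override, _ => ⟨s.a - s.h - 1, 1, .relevant⟩
  | .matching, b => race s b
  | .wait, b =>
    match s.fork with
    | .active => race s b
    | _ => extend s b

/-- The immediate rewards (accepted blocks of the attacker, accepted blocks of the others). -/
def reward (s : State) : Action → Block → ℕ × ℕ
  | .adopt, _ => (0, s.h)
  | .override, _ => (s.h + 1, 0)
  | .matching, b => raceReward s b
  | .wait, b =>
    match s.fork with
    | .active => raceReward s b
    | _ => (0, 0)

/-- The law of the creator of a block: `α`, `(1 - γ) (1 - α)`, `γ (1 - α)`. -/
noncomputable def blockLaw (α γ : unitInterval) : Measure Block :=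
  ENNReal.ofReal α • Measure.dirac .attacker
    + ENNReal.ofReal ((1 - γ) * (1 - α)) • Measure.dirac .honestOwn
    + ENNReal.ofReal (γ * (1 - α)) • Measure.dirac .honestSplit

instance (α γ : unitInterval) : IsProbabilityMeasure (blockLaw α γ) := by
  constructor
  have h0 := α.2.1
  have h1 : (0 : ℝ) ≤ 1 - α := sub_nonneg.2 α.2.2
  have g0 := γ.2.1
  have g1 : (0 : ℝ) ≤ 1 - γ := sub_nonneg.2 γ.2.2
  simp only [blockLaw, Measure.add_apply, Measure.smul_apply, measure_univ, smul_eq_mul, mul_one]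
  rw [← ENNReal.ofReal_add h0 (mul_nonneg g1 h1),
    ← ENNReal.ofReal_add (add_nonneg h0 (mul_nonneg g1 h1)) (mul_nonneg g0 h1),
    ← ENNReal.ofReal_one]
  congr 1
  ring

/-- The law of the sequence of independent block creations. -/
noncomputable def blocksLaw (α γ : unitInterval) : Measure (ℕ → Block) :=
  Measure.infinitePi fun _ => blockLaw α γ

/-- A (stationary, deterministic) policy. -/
abbrev Policy := State → Action

/-- The state `X_t` visited at time `t` under `π`, as a function of the created blocks. -/
def chain (π : Policy) (ω : ℕ → Block) : ℕ → State
  | 0 => initial (ω 0)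
  | t + 1 => step (chain π ω t) (π (chain π ω t)) (ω (t + 1))

/-- The rewards `r_t` of the transition from `X_t` to `X_{t+1}`. -/
def rewardAt (π : Policy) (ω : ℕ → Block) (t : ℕ) : ℕ × ℕ :=
  reward (chain π ω t) (π (chain π ω t)) (ω (t + 1))

/-- The time that elapses from time `t` until the next action other than `wait`. -/
noncomputable def waitingTime (π : Policy) (t : ℕ) (ω : ℕ → Block) : ENNReal :=
  ⨅ (n : ℕ) (_ : π (chain π ω (t + n)) ≠ .wait), (n : ENNReal)

/-- The admissible policies (the set `A`): only feasible actions are taken, and at every time the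
expected time until the next action other than `wait` is finite. -/
structure IsAdmissible (α γ : unitInterval) (π : Policy) : Prop where
  feasible : ∀ s, Feasible s (π s)
  finite_wait : ∀ t, ∫⁻ ω, waitingTime π t ω ∂(blocksLaw α γ) < ⊤

/-- The relative revenue of the attacker,
`E [ liminf_N (∑_{t=1}^N r¹_t) / (∑_{t=1}^N (r¹_t + r²_t)) ]`. -/
noncomputable def REV (π : Policy) (α γ : unitInterval) : ℝ :=
  ∫ ω, liminf (fun N : ℕ =>
    (∑ t ∈ Finset.Icc 1 N, ((rewardAt π ω t).1 : ℝ)) /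
      ∑ t ∈ Finset.Icc 1 N, (((rewardAt π ω t).1 : ℝ) + ((rewardAt π ω t).2 : ℝ))) atTop
    ∂(blocksLaw α γ)

/-- Honest mining. -/
def honest : Policy := fun s =>
  if s.a < s.h then .adopt else if s.h < s.a then .override else .wait

/-- `π` is an admissible policy of maximal relative revenue. -/
def IsOptimal (π : Policy) (α γ : unitInterval) : Prop :=
  IsAdmissible α γ π ∧ ∀ π', IsAdmissible α γ π' → REV π' α γ ≤ REV π α γ

/-- The profit threshold: the infimum of all `α` for which some admissible policy has a larger
relative revenue than honest mining. The extended reals give the empty set the infimum `⊤`. -/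
noncomputable def profitThreshold (γ : unitInterval) : EReal :=
  sInf {x | ∃ α : unitInterval, x = ((α : ℝ) : EReal) ∧
    ∃ π, IsAdmissible α γ π ∧ REV honest α γ < REV π α γ}

/-- The linear reward `w_ρ (x, y) = (1 - ρ) x - ρ y`. -/
def w (ρ : ℝ) (r : ℕ × ℕ) : ℝ := (1 - ρ) * r.1 - ρ * r.2

/-- The compensation paid in a truncating state `(a, h)` of the over-paying process. -/
noncomputable def compensation (α ρ : ℝ) (s : State) : ℝ :=
  if s.h ≤ s.a then
    (1 - ρ) * (α * (1 - α) / (1 - 2 * α) ^ 2)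
      + 1 / 2 * (((s.a : ℝ) - s.h) / (1 - 2 * α) + s.a + s.h)
  else
    (1 - (α / (1 - α)) ^ (s.h - s.a)) * (-ρ * s.h)
      + (α / (1 - α)) ^ (s.h - s.a) * (1 - ρ)
        * (α * (1 - α) / (1 - 2 * α) ^ 2 + ((s.h : ℝ) - s.a) / (1 - 2 * α))

/-- The immediate reward in the over-paying process with truncation `T`: in the truncating states,
where only `adopt` is allowed, the compensation takes the place of the reward of `adopt`. -/
noncomputable def overReward (α ρ : ℝ) (T : ℕ) (s : State) (x : Action) (b : Block) : ℝ :=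
  if max s.a s.h = T then compensation α ρ s else w ρ (reward s x b)

/-- The policies of the truncated processes (the set `A^T`): only `adopt` is allowed in the states
with `max a h = T`. As the reached states are bounded, no such policy waits for ever. -/
structure IsTruncated (T : ℕ) (π : Policy) : Prop where
  feasible : ∀ s, Feasible s (π s)
  truncate : ∀ s : State, max s.a s.h = T → π s = .adopt

/-- The value of a policy in the over-paying process: the expected liminf of the average reward. -/
noncomputable def overValue (α γ : unitInterval) (ρ : ℝ) (T : ℕ) (π : Policy) : ℝ :=
  ∫ ω, liminf (fun N : ℕ => 1 / (N : ℝ) *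
    ∑ t ∈ Finset.Icc 1 N, overReward α ρ T (chain π ω t) (π (chain π ω t)) (ω (t + 1))) atTop
    ∂(blocksLaw α γ)

/-- The optimal value of the over-paying process, with `ρ = α`, when `override` is removed from the
feasible actions in `(1, 0)`. -/
noncomputable def optValueNoOverride (α γ : unitInterval) (T : ℕ) : ℝ :=
  sSup (overValue α γ α T '' {π | IsTruncated T π ∧ ∀ f, π ⟨1, 0, f⟩ ≠ .override})

/-- The optimal value of the over-paying process, with `ρ = α`, when `adopt` is removed from the
feasible actions in `(0, 1)`. -/
noncomputable def optValueNoAdopt (α γ : unitInterval) (T : ℕ) : ℝ :=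
  sSup (overValue α γ α T '' {π | IsTruncated T π ∧ ∀ f, π ⟨0, 1, f⟩ ≠ .adopt})

/-- `u` is an admissible answer, with error parameter `ε`, of a solver for a process whose optimal
value is `v`. -/
def IsSolverOutput (v ε u : ℝ) : Prop := |u - v| < ε

end SelfishMining

namespace SelfishMining

/-! The argument has two halves, joined by one inequality on the odds `x = α / (1 - α)`, the field
`withhold` of `Unprofitable`: withholding the first block does not pay.

Multiply the rewards by `1 + x`, so that they read `r¹ - x r²`, and measure values against the
baseline in which each block is credited to its miner (this is the `a - x * h` in the potentials).
Then an orphaned honest block is worth `x` and an orphaned attacker block costs `1`. With a lead one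
waits for lead one and overrides, which gives the explicit `leadValue`. Behind, one faces an optimal
stopping problem with value `catchUp`. The only open question is whether withholding at `(1, 0)` and
matching at `(1, 1)` has positive value.

Suppose the inequality fails, or `x > 1 / 2`. Then an explicit policy that never overrides at `(1,
0)` has a submartingale potential in the over-paying process (`Profitable.pot_le_mean`), so its
value there is nonnegative (`Profitable.overValue_nonneg`). This contradicts the negative optimal
value forced by `u₁ ≤ -ε`. The delicate point is that the compensation for `T = h` may be less than
the true continuation value. A reflection identity bounds this loss by what the compensation for `T
= a` adds.

Suppose the inequality holds and `x ≤ 1 / 2`. Then for all odds `y ≤ x`,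
`Unprofitable.mean_reward_add_potential_le` gives a potential that bounds the linear reward of every
policy. A strong law, with second moments controlled by `lyapunov`, turns this into a pathwise
bound, evaluated at times at which the policy does not wait. Hence every admissible policy earns at
most `y / (1 + y)`, the revenue of honest mining. Having this for all `y ≤ x` yields the bound on
the threshold too. -/

/-! ### Strong law of large numbers for orthogonal sequences -/

theorem ae_tendsto_zero_of_integral_le {Ω : Type*} [MeasurableSpace Ω] {μ : Measure Ω}
    (U : ℕ → Ω → ℝ) (hU : ∀ k ω, 0 ≤ U k ω) (hint : ∀ k, Integrable (U k) μ)
    (c : ℕ → ℝ) (hc : Summable c) (hle : ∀ k, ∫ ω, U k ω ∂μ ≤ c k) :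
    ∀ᵐ ω ∂μ, Tendsto (fun k => U k ω) atTop (nhds 0) := by
  have h1 : ∫⁻ ω, ∑' k, ENNReal.ofReal (U k ω) ∂μ ≠ ⊤ := by
    rw [lintegral_tsum fun k => (hint k).aemeasurable.ennreal_ofReal]
    refine ne_top_of_le_ne_top hc.tsum_ofReal_ne_top (ENNReal.tsum_le_tsum fun k => ?_)
    rw [← ofReal_integral_eq_lintegral_ofReal (hint k) (ae_of_all _ (hU k))]
    exact ENNReal.ofReal_le_ofReal (hle k)
  have h2 := ae_lt_top' (AEMeasurable.tsum
    fun k => (hint k).aemeasurable.ennreal_ofReal) h1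
  filter_upwards [h2] with ω hω
  have h3 := ENNReal.tendsto_atTop_zero_of_tsum_ne_top hω.ne
  have h4 := (ENNReal.tendsto_toReal ENNReal.zero_ne_top).comp h3
  simpa [Function.comp_def, ENNReal.toReal_ofReal (hU _ ω)] using h4

theorem integral_sq_sum_le_of_orthogonal {Ω : Type*} [MeasurableSpace Ω] {μ : Measure Ω}
    (D : ℕ → Ω → ℝ) (hm : ∀ t, MemLp (D t) 2 μ)
    (horth : ∀ s t, s < t → ∫ ω, D s ω * D t ω ∂μ = 0) (C : ℝ)
    (hC : ∀ t, ∫ ω, D t ω ^ 2 ∂μ ≤ C) (N : ℕ) :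
    ∫ ω, (∑ t ∈ Finset.range N, D t ω) ^ 2 ∂μ ≤ C * N := by
  have hp : ∀ s t, Integrable (fun ω => D s ω * D t ω) μ := fun s t => (hm s).integrable_mul (hm t)
  induction N with
  | zero => simp
  | succ N ih =>
    have hS : MemLp (fun ω => ∑ t ∈ Finset.range N, D t ω) 2 μ := memLp_finsetSum _ fun t _ => hm t
    have hcross : ∫ ω, (∑ t ∈ Finset.range N, D t ω) * D N ω ∂μ = 0 := by
      simp_rw [Finset.sum_mul]
      rw [integral_finsetSum _ fun t _ => hp t N]
      exact Finset.sum_eq_zero fun t ht => horth t N (Finset.mem_range.1 ht)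
    have : ∀ ω, (∑ t ∈ Finset.range (N + 1), D t ω) ^ 2 = ((∑ t ∈ Finset.range N, D t ω) ^ 2
        + 2 * ((∑ t ∈ Finset.range N, D t ω) * D N ω)) + D N ω ^ 2 := by
      intro ω; rw [Finset.sum_range_succ]; ring
    simp_rw [this]
    have i1 := hS.integrable_sq
    have i2 : Integrable (fun ω => 2 * ((∑ t ∈ Finset.range N, D t ω) * D N ω)) μ :=
      (hS.integrable_mul (hm N)).const_mul 2
    have i12 : Integrable (fun ω => (∑ t ∈ Finset.range N, D t ω) ^ 2
        + 2 * ((∑ t ∈ Finset.range N, D t ω) * D N ω)) μ := i1.add i2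
    rw [integral_add i12 (hm N).integrable_sq, integral_add i1 i2,
      integral_const_mul, hcross]
    have := hC N
    push_cast
    linarith

/-- Orthogonality gives a variance `O(N)`, so along `N = k ^ 2` the averages have summable second
moments. Between consecutive squares there are only `2 k + 1` terms, and the sum of their absolute
values is controlled by Cauchy–Schwarz. -/
theorem ae_tendsto_average_of_orthogonal {Ω : Type*} [MeasurableSpace Ω] {μ : Measure Ω}
    (D : ℕ → Ω → ℝ) (hm : ∀ t, MemLp (D t) 2 μ)
    (horth : ∀ s t, s < t → ∫ ω, D s ω * D t ω ∂μ = 0) (C : ℝ)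
    (hC : ∀ t, ∫ ω, D t ω ^ 2 ∂μ ≤ C) :
    ∀ᵐ ω ∂μ, Tendsto (fun N : ℕ => (∑ t ∈ Finset.range N, D t ω) / N) atTop (nhds 0) := by
  set S : ℕ → Ω → ℝ := fun N ω => ∑ t ∈ Finset.range N, D t ω with hS
  set G : ℕ → Ω → ℝ := fun k ω => ∑ t ∈ Finset.Ico (k ^ 2) ((k + 1) ^ 2), |D t ω| with hG
  have hC0 : 0 ≤ C := le_trans (integral_nonneg fun ω => sq_nonneg _) (hC 0)
  have hSm : ∀ N, MemLp (S N) 2 μ := fun N => memLp_finsetSum _ fun t _ => hm t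
  have hGm : ∀ k, MemLp (G k) 2 μ := fun k => memLp_finsetSum _ fun t _ => (hm t).abs
  have hcard : ∀ k : ℕ, (((Finset.Ico (k ^ 2) ((k + 1) ^ 2)).card : ℕ) : ℝ) = 2 * k + 1 := by
    intro k
    rw [Nat.card_Ico, Nat.cast_sub (by gcongr; omega)]
    push_cast; ring
  have hGi : ∀ k : ℕ, ∫ ω, G k ω ^ 2 ∂μ ≤ (2 * k + 1) ^ 2 * C := by
    intro k
    calc ∫ ω, G k ω ^ 2 ∂μ
        ≤ ∫ ω, (2 * k + 1 : ℝ) * ∑ t ∈ Finset.Ico (k ^ 2) ((k + 1) ^ 2), D t ω ^ 2 ∂μ := by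
          refine integral_mono (hGm k).integrable_sq
            ((integrable_finsetSum _ fun t _ => (hm t).integrable_sq).const_mul _) fun ω => ?_
          have := sq_sum_le_card_mul_sum_sq (s := Finset.Ico (k ^ 2) ((k + 1) ^ 2))
            (f := fun t => |D t ω|)
          simp only [hcard, sq_abs] at this
          exact this
      _ = (2 * k + 1 : ℝ) * ∑ t ∈ Finset.Ico (k ^ 2) ((k + 1) ^ 2), ∫ ω, D t ω ^ 2 ∂μ := by
          rw [integral_const_mul, integral_finsetSum _ fun t _ => (hm t).integrable_sq]
      _ ≤ (2 * k + 1 : ℝ) * ((2 * k + 1) * C) := by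
          gcongr
          refine (Finset.sum_le_card_nsmul _ _ C fun t _ => hC t).trans ?_
          rw [nsmul_eq_mul, hcard]
      _ = _ := by ring
  set U : ℕ → Ω → ℝ := fun k ω => (S (k ^ 2) ω ^ 2 + G k ω ^ 2) / (k : ℝ) ^ 4 with hU
  have hUi : ∀ k, ∫ ω, U k ω ∂μ ≤ 10 * C * (1 / (k : ℝ) ^ 2) := by
    intro k
    -- For `k = 0` both sides vanish because division by zero gives zero.
    rcases Nat.eq_zero_or_pos k with rfl | hk
    · simp [hU]
    have hk' : (1 : ℝ) ≤ k := by exact_mod_cast hk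
    simp only [hU]
    rw [integral_div, integral_add (hSm _).integrable_sq (hGm _).integrable_sq]
    have h1 := integral_sq_sum_le_of_orthogonal D hm horth C hC (k ^ 2)
    have h2 := hGi k
    rw [div_le_iff₀ (by positivity)]
    have h3 : (10 * C * (1 / (k : ℝ) ^ 2)) * (k : ℝ) ^ 4 = 10 * C * (k : ℝ) ^ 2 := by
      field_simp
    rw [h3]
    push_cast at h1
    have h4 : ((2 * k + 1 : ℝ)) ^ 2 * C ≤ 9 * (k : ℝ) ^ 2 * C := by
      gcongr
      nlinarith
    linarith
  have hsum : Summable fun k : ℕ => 10 * C * (1 / (k : ℝ) ^ 2) :=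
    (Real.summable_one_div_nat_pow.2 (by norm_num)).mul_left _
  have key := ae_tendsto_zero_of_integral_le U (fun k ω => by positivity)
    (fun k => ((hSm _).integrable_sq.add (hGm _).integrable_sq).div_const _) _ hsum hUi
  filter_upwards [key] with ω hω
  have hsqrt : Tendsto Nat.sqrt atTop atTop := by
    refine tendsto_atTop_mono' (f₁ := fun n => Nat.sqrt n) atTop (EventuallyLE.refl _ _) ?_
    refine tendsto_atTop.2 fun b => ?_
    filter_upwards [eventually_ge_atTop (b * b)] with n hn
    exact Nat.le_sqrt.2 hn
  have h0 : Tendsto (fun N : ℕ => 2 * √(U (Nat.sqrt N) ω)) atTop (nhds 0) := by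
    have := ((hω.comp hsqrt).sqrt).const_mul 2
    simpa using this
  refine squeeze_zero_norm' ?_ h0
  filter_upwards [eventually_ge_atTop 1] with N hN
  set k := Nat.sqrt N with hk
  have hk1 : 1 ≤ k := Nat.le_sqrt.2 (by simpa using hN)
  have hkN : k ^ 2 ≤ N := Nat.sqrt_le' N
  have hNk : N < (k + 1) ^ 2 := Nat.lt_succ_sqrt' N
  have hk0 : (0 : ℝ) < (k : ℝ) ^ 2 := by positivity
  have hSN : |S N ω| ≤ |S (k ^ 2) ω| + G k ω := by
    have : S N ω = S (k ^ 2) ω + ∑ t ∈ Finset.Ico (k ^ 2) N, D t ω :=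
      (Finset.sum_range_add_sum_Ico _ hkN).symm
    rw [this]
    refine (abs_add_le _ _).trans (add_le_add le_rfl ?_)
    refine (Finset.abs_sum_le_sum_abs _ _).trans ?_
    exact Finset.sum_le_sum_of_subset_of_nonneg
      (Finset.Ico_subset_Ico_right hNk.le) fun _ _ _ => abs_nonneg _
  have hG0 : 0 ≤ G k ω := Finset.sum_nonneg fun _ _ => abs_nonneg _
  have hb : ∀ y : ℝ, 0 ≤ y → y ^ 2 ≤ S (k ^ 2) ω ^ 2 + G k ω ^ 2 → y ≤ √(U k ω) * (k : ℝ) ^ 2 := by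
    intro y hy hy2
    rw [← div_le_iff₀ hk0]
    refine Real.le_sqrt_of_sq_le ?_
    rw [div_pow, ← pow_mul]
    exact div_le_div_of_nonneg_right hy2 (by positivity)
  have h1 := hb _ (abs_nonneg (S (k ^ 2) ω)) (by rw [sq_abs]; nlinarith [sq_nonneg (G k ω)])
  have h2 := hb _ hG0 (by nlinarith [sq_nonneg (S (k ^ 2) ω)])
  rw [Real.norm_eq_abs, abs_div, Nat.abs_cast, div_le_iff₀ (by exact_mod_cast hN)]
  have hkN' : (k : ℝ) ^ 2 ≤ N := by exact_mod_cast hkN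
  calc |S N ω| ≤ 2 * √(U k ω) * (k : ℝ) ^ 2 := by linarith
    _ ≤ 2 * √(U k ω) * N := by gcongr

/-! ### The chain driven by independent blocks -/

instance : Fintype Block where
  elems := ⟨↑[Block.attacker, .honestOwn, .honestSplit], by simp⟩
  complete b := by cases b <;> simp

instance : Fintype Fork where
  elems := ⟨↑[Fork.irrelevant, .relevant, .active], by simp⟩
  complete b := by cases b <;> simp

instance : DiscreteMeasurableSpace Block := ⟨fun _ => trivial⟩

instance : MeasurableSpace State := ⊤

instance : DiscreteMeasurableSpace State := ⟨fun _ => trivial⟩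

theorem State.injective_toProd :
    Function.Injective fun s : State => (s.a, s.h, s.fork) := by
  rintro ⟨a, h, f⟩ ⟨a', h', f'⟩ e
  simp_all

instance : Countable State := State.injective_toProd.countable

theorem finite_setOf_le (A H : ℕ) : {s : State | s.a ≤ A ∧ s.h ≤ H}.Finite := by
  refine Set.Finite.of_finite_image (f := fun s : State => (s.a, s.h, s.fork)) ?_
    State.injective_toProd.injOn
  refine ((Set.finite_Iic A).prod ((Set.finite_Iic H).prod (Set.finite_univ (α := Fork)))).subset ?_
  rintro _ ⟨s, hs, rfl⟩
  exact ⟨hs.1, hs.2, trivial⟩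

instance (α γ : unitInterval) : IsProbabilityMeasure (blocksLaw α γ) := by
  unfold blocksLaw; infer_instance

/-- The mean of a function of the creator of a block. -/
noncomputable def blockMean (α γ : ℝ) (f : Block → ℝ) : ℝ :=
  α * f .attacker + (1 - γ) * (1 - α) * f .honestOwn + γ * (1 - α) * f .honestSplit

theorem integral_blockLaw (α γ : unitInterval) (f : Block → ℝ) :
    ∫ b, f b ∂(blockLaw α γ) = blockMean α γ f := by
  have h0 := α.2.1
  have h1 : (0 : ℝ) ≤ 1 - α := sub_nonneg.2 α.2.2
  have g0 := γ.2.1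
  have g1 : (0 : ℝ) ≤ 1 - γ := sub_nonneg.2 γ.2.2
  have hi : ∀ (c : ℝ) (b : Block), Integrable f (ENNReal.ofReal c • Measure.dirac b) :=
    fun c b => (integrable_dirac (by simp)).smul_measure ENNReal.ofReal_ne_top
  rw [blockLaw, integral_add_measure ((hi _ _).add_measure (hi _ _)) (hi _ _),
    integral_add_measure (hi _ _) (hi _ _)]
  simp only [integral_smul_measure, integral_dirac, smul_eq_mul, blockMean]
  rw [ENNReal.toReal_ofReal h0, ENNReal.toReal_ofReal (mul_nonneg g1 h1),
    ENNReal.toReal_ofReal (mul_nonneg g0 h1)]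

/-- Resampling one coordinate leaves a product measure unchanged. With Fubini this does the work of
conditional expectations: everything determined by the other coordinates is frozen while the block
at `n` is averaged. -/
theorem measurePreserving_update {ι X : Type*} [DecidableEq ι] [MeasurableSpace X]
    (μ : Measure X) [IsProbabilityMeasure μ] (n : ι) :
    MeasurePreserving (fun p : (ι → X) × X => Function.update p.1 n p.2)
      ((Measure.infinitePi fun _ : ι => μ).prod μ) (Measure.infinitePi fun _ : ι => μ) := by
  have hmeas : Measurable fun p : (ι → X) × X => Function.update p.1 n p.2 := by
    refine measurable_pi_iff.2 fun i => ?_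
    by_cases hi : i = n
    · subst hi; simpa using measurable_snd
    · simp only [Function.update_of_ne hi]
      exact (measurable_pi_apply i).comp measurable_fst
  refine ⟨hmeas, Measure.eq_infinitePi _ fun s t ht => ?_⟩
  rw [Measure.map_apply hmeas (MeasurableSet.pi s.countable_toSet fun i _ => ht i)]
  by_cases hn : n ∈ s
  · have : (fun p : (ι → X) × X => Function.update p.1 n p.2) ⁻¹' Set.pi (s : Set ι) t
        = (Set.pi ((s.erase n : Finset ι) : Set ι) t) ×ˢ t n := by
      ext p
      simp only [Set.mem_preimage, Set.mem_pi, Set.mem_prod, Finset.coe_erase, Set.mem_sdiff,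
        Finset.mem_coe, Set.mem_singleton_iff]
      constructor
      · intro h
        refine ⟨fun i hi => ?_, by simpa using h n hn⟩
        simpa [hi.2] using h i hi.1
      · rintro ⟨h, h'⟩ i hi
        by_cases hin : i = n
        · subst hin; simpa using h'
        · simpa [hin] using h i ⟨hi, hin⟩
    rw [this, Measure.prod_prod, Measure.infinitePi_pi _ fun i _ => ht i,
      Finset.prod_erase_mul _ _ hn]
  · have : (fun p : (ι → X) × X => Function.update p.1 n p.2) ⁻¹' Set.pi (s : Set ι) t
        = (Set.pi (s : Set ι) t) ×ˢ Set.univ := by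
      ext p
      simp only [Set.mem_preimage, Set.mem_pi, Set.mem_prod, Finset.mem_coe, Set.mem_univ, and_true]
      refine forall₂_congr fun i hi => ?_
      rw [Function.update_of_ne (ne_of_mem_of_not_mem hi hn)]
    rw [this, Measure.prod_prod, Measure.infinitePi_pi _ fun i _ => ht i, measure_univ, mul_one]

theorem chain_update_of_lt (π : Policy) (ω : ℕ → Block) (b : Block) {t n : ℕ} (h : t < n) :
    chain π (Function.update ω n b) t = chain π ω t := by
  induction t with
  | zero => simp [chain, Function.update_of_ne h.ne]
  | succ t ih => simp only [chain, ih (by omega), Function.update_of_ne h.ne]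

theorem measurable_chain (π : Policy) (t : ℕ) : Measurable fun ω => chain π ω t := by
  induction t with
  | zero => exact (Measurable.of_discrete (f := initial)).comp (measurable_pi_apply 0)
  | succ t ih =>
    exact (Measurable.of_discrete (f := fun p : State × Block => step p.1 (π p.1) p.2)).comp
      (ih.prodMk (measurable_pi_apply (t + 1)))

theorem finite_range_chain (π : Policy) (t : ℕ) : (Set.range fun ω => chain π ω t).Finite := by
  induction t with
  | zero =>
    refine (Set.finite_range initial).subset ?_
    rintro _ ⟨ω, rfl⟩
    exact ⟨ω 0, rfl⟩
  | succ t ih =>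
    refine (Set.Finite.image2 (fun s b => step s (π s) b) ih (Set.finite_univ (α := Block))).subset ?_
    rintro _ ⟨ω, rfl⟩
    exact ⟨_, ⟨ω, rfl⟩, ω (t + 1), trivial, rfl⟩

theorem exists_bound_chain (π : Policy) (f : State → Block → ℝ) (t : ℕ) :
    ∃ C, ∀ ω b, |f (chain π ω t) b| ≤ C := by
  obtain ⟨C, hC⟩ := ((finite_range_chain π t).image2 (fun s b => |f s b|)
    (Set.finite_univ (α := Block))).bddAbove
  exact ⟨C, fun ω b => hC ⟨_, ⟨ω, rfl⟩, b, trivial, rfl⟩⟩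

theorem measurable_chain_block (π : Policy) (f : State → Block → ℝ) (t n : ℕ) :
    Measurable fun ω : ℕ → Block => f (chain π ω t) (ω n) :=
  (Measurable.of_discrete (f := fun p : State × Block => f p.1 p.2)).comp
    ((measurable_chain π t).prodMk (measurable_pi_apply n))

theorem memLp_chain_block (α γ : unitInterval) (π : Policy) (f : State → Block → ℝ) (t n : ℕ)
    (p : ENNReal) : MemLp (fun ω : ℕ → Block => f (chain π ω t) (ω n)) p (blocksLaw α γ) := by
  obtain ⟨C, hC⟩ := exists_bound_chain π f t
  exact MemLp.of_bound (measurable_chain_block π f t n).aestronglyMeasurable C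
    (ae_of_all _ fun ω => hC ω _)

theorem integrable_chain (α γ : unitInterval) (π : Policy) (f : State → ℝ) (t : ℕ) :
    Integrable (fun ω => f (chain π ω t)) (blocksLaw α γ) :=
  memLp_one_iff_integrable.1 (memLp_chain_block α γ π (fun s _ => f s) t 0 1)

/-- Conditioning on the blocks up to time `t`. -/
theorem integral_mul_next (α γ : unitInterval) (π : Policy) (K : (ℕ → Block) → ℝ) (t : ℕ)
    (hK : ∀ ω b, K (Function.update ω (t + 1) b) = K ω) (hKm : Measurable K) (C : ℝ)
    (hKb : ∀ ω, |K ω| ≤ C) (f : State → Block → ℝ) :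
    ∫ ω, K ω * f (chain π ω t) (ω (t + 1)) ∂(blocksLaw α γ)
      = ∫ ω, K ω * blockMean α γ (f (chain π ω t)) ∂(blocksLaw α γ) := by
  have hmp := measurePreserving_update (blockLaw α γ) (t + 1)
  obtain ⟨C', hC'⟩ := exists_bound_chain π f t
  have hmeas : Measurable fun ω : ℕ → Block => K ω * f (chain π ω t) (ω (t + 1)) :=
    hKm.mul (measurable_chain_block π f t (t + 1))
  unfold blocksLaw
  rw [← hmp.map_eq, integral_map hmp.measurable.aemeasurable hmeas.aestronglyMeasurable, hmp.map_eq,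
    integral_prod]
  · refine integral_congr_ae (ae_of_all _ fun ω => ?_)
    simp only [hK, chain_update_of_lt π ω _ (Nat.lt_succ_self t), Function.update_self]
    rw [integral_const_mul, integral_blockLaw]
  · refine Integrable.of_bound (hmeas.comp hmp.measurable).aestronglyMeasurable (C * C')
      (ae_of_all _ fun p => ?_)
    rw [norm_mul]
    exact mul_le_mul (hKb _) (hC' _ _) (abs_nonneg _) ((abs_nonneg _).trans (hKb p.1))

theorem integral_next (α γ : unitInterval) (π : Policy) (t : ℕ) (f : State → Block → ℝ) :
    ∫ ω, f (chain π ω t) (ω (t + 1)) ∂(blocksLaw α γ)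
      = ∫ ω, blockMean α γ (f (chain π ω t)) ∂(blocksLaw α γ) := by
  simpa using integral_mul_next α γ π (fun _ => 1) t (fun _ _ => rfl) measurable_const 1
    (fun _ => by simp) f

theorem blockMean_const (α γ c : ℝ) : blockMean α γ (fun _ => c) = c := by
  unfold blockMean; ring

theorem blockMean_sub (α γ : ℝ) (f g : Block → ℝ) :
    blockMean α γ (fun b => f b - g b) = blockMean α γ f - blockMean α γ g := by
  unfold blockMean; ring

theorem blockMean_mono (α γ : unitInterval) {f g : Block → ℝ} (h : ∀ b, f b ≤ g b) :
    blockMean α γ f ≤ blockMean α γ g := by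
  have h0 := α.2.1
  have h1 : (0 : ℝ) ≤ 1 - α := sub_nonneg.2 α.2.2
  have g0 := γ.2.1
  have g1 : (0 : ℝ) ≤ 1 - γ := sub_nonneg.2 γ.2.2
  unfold blockMean
  gcongr <;> apply h

/-- Strong law of large numbers along the chain. -/
theorem ae_tendsto_average_chain (α γ : unitInterval) (π : Policy) (f : State → Block → ℝ) (C : ℝ)
    (hC : ∀ t, ∫ ω, (f (chain π ω t) (ω (t + 1)) - blockMean α γ (f (chain π ω t))) ^ 2
      ∂(blocksLaw α γ) ≤ C) :
    ∀ᵐ ω ∂(blocksLaw α γ), Tendsto (fun N : ℕ => (∑ t ∈ Finset.Icc 1 N,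
      (f (chain π ω t) (ω (t + 1)) - blockMean α γ (f (chain π ω t)))) / N) atTop (nhds 0) := by
  set g : State → Block → ℝ := fun s b => f s b - blockMean α γ (f s) with hg
  have hg0 : ∀ s, blockMean α γ (g s) = 0 := fun s => by
    rw [hg]; simp only; rw [blockMean_sub, blockMean_const, sub_self]
  have key := ae_tendsto_average_of_orthogonal (μ := blocksLaw α γ)
    (fun t ω => g (chain π ω (t + 1)) (ω (t + 1 + 1)))
    (fun t => memLp_chain_block α γ π g _ _ 2) (fun s t hst => ?_) C (fun t => hC (t + 1))
  · filter_upwards [key] with ω hω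
    refine hω.congr fun N => ?_
    rw [Finset.range_eq_Ico, Finset.sum_Ico_add' (fun t => g (chain π ω t) (ω (t + 1))) 0 N 1]
    rfl
  · obtain ⟨B, hB⟩ := exists_bound_chain π g (s + 1)
    rw [integral_mul_next α γ π (fun ω => g (chain π ω (s + 1)) (ω (s + 1 + 1))) (t + 1)
      (fun ω b => ?_) (measurable_chain_block π g _ _) B (fun ω => hB _ _) g]
    · simp [hg0]
    · rw [chain_update_of_lt π ω b (by omega), Function.update_of_ne (by omega)]

/-! ### Optimal stopping for an attacker that is not ahead -/

/-- Value iteration for the stopping problem of an attacker that is not ahead, in units in which an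
orphaned honest block is worth `x = α / (1 - α)` and an orphaned block of the attacker costs `1`:
stop by adopting, or catch up and override at the first lead. -/
noncomputable def catchUpIter (x : ℝ) : ℕ → ℕ → ℕ → ℝ
  | 0, a, h => if h < a then x * h else -a
  | n + 1, a, h => if h < a then x * h else
      max (-(a : ℝ)) ((x * catchUpIter x n (a + 1) h + catchUpIter x n a (h + 1)) / (1 + x))

theorem catchUpIter_of_lt {x : ℝ} {a h : ℕ} (hah : h < a) (n : ℕ) : catchUpIter x n a h = x * h := by
  cases n <;> simp [catchUpIter, hah]

theorem catchUpIter_succ_of_le {x : ℝ} {a h : ℕ} (hah : a ≤ h) (n : ℕ) :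
    catchUpIter x (n + 1) a h =
      max (-(a : ℝ)) ((x * catchUpIter x n (a + 1) h + catchUpIter x n a (h + 1)) / (1 + x)) := by
  simp [catchUpIter, hah.not_gt]

theorem neg_le_catchUpIter {x : ℝ} {a h : ℕ} (hah : a ≤ h) (n : ℕ) :
    -(a : ℝ) ≤ catchUpIter x n a h := by
  cases n <;> simp [catchUpIter, hah.not_gt]

theorem catchUpIter_mono {x : ℝ} (hx : 0 ≤ x) (n a h : ℕ) :
    catchUpIter x n a h ≤ catchUpIter x (n + 1) a h := by
  induction n generalizing a h with
  | zero =>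
    by_cases hah : h < a
    · simp [catchUpIter_of_lt hah]
    · rw [catchUpIter_succ_of_le (not_lt.1 hah)]
      simp [catchUpIter, hah]
  | succ n ih =>
    by_cases hah : h < a
    · simp [catchUpIter_of_lt hah]
    · rw [catchUpIter_succ_of_le (not_lt.1 hah), catchUpIter_succ_of_le (not_lt.1 hah)]
      have := ih (a + 1) h
      have := ih a (h + 1)
      gcongr

/-- The value of an attacker at deficit `d` that foresees whether it ever gets ahead. -/
noncomputable def prophetValue (x : ℝ) (a h : ℕ) : ℝ :=
  -a + x ^ (h + 1 - a) * (x * (h + ((h : ℝ) + 1 - a) * x / (1 - x)) + a)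

/-- The prophet adopts at once if the walk never gets ahead, and otherwise waits until it does;
conditioned on getting ahead, the walk has its odds inverted. The defect `x * (1 - x ^ d)` is the
cost of one further attacker block in a race that is still lost, which the prophet avoids. -/
theorem prophetValue_step {x : ℝ} (hx : 0 ≤ x) (hx1 : x < 1) {a h : ℕ} (hah : a ≤ h) :
    x * prophetValue x (a + 1) h + prophetValue x a (h + 1) ≤ (1 + x) * prophetValue x a h := by
  obtain ⟨d, rfl⟩ := Nat.exists_eq_add_of_le hah
  have e1 : a + d + 1 - (a + 1) = d := by omega
  have e2 : a + d + 1 + 1 - a = d + 2 := by omega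
  have e3 : a + d + 1 - a = d + 1 := by omega
  have h1 : 1 - x ≠ 0 := by linarith
  have hp : x ^ d ≤ 1 := pow_le_one₀ hx hx1.le
  simp only [prophetValue, e1, e2, e3]
  push_cast
  have : (1 + x) * (-(a : ℝ) + x ^ (d + 1) * (x * (a + d + ((a : ℝ) + d + 1 - a) * x / (1 - x)) + a))
      - (x * (-((a : ℝ) + 1) + x ^ d * (x * (a + d + ((a : ℝ) + d + 1 - (a + 1)) * x / (1 - x)) + (a + 1)))
        + (-(a : ℝ) + x ^ (d + 2) * (x * (a + d + 1 + ((a : ℝ) + d + 1 + 1 - a) * x / (1 - x)) + a)))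
      = x * (1 - x ^ d) := by
    field_simp
    ring
  nlinarith [mul_nonneg hx (sub_nonneg.2 hp)]

theorem neg_le_prophetValue {x : ℝ} (hx : 0 ≤ x) (hx1 : x < 1) {a h : ℕ} (hah : a ≤ h) :
    -(a : ℝ) ≤ prophetValue x a h := by
  have : (a : ℝ) ≤ h := by exact_mod_cast hah
  have h1 : 0 < 1 - x := by linarith
  have h2 : (0 : ℝ) ≤ (h : ℝ) + 1 - a := by linarith
  have : 0 ≤ x ^ (h + 1 - a) * (x * (h + ((h : ℝ) + 1 - a) * x / (1 - x)) + a) := by positivity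
  unfold prophetValue
  linarith

theorem catchUpIter_le_prophetValue {x : ℝ} (hx : 0 ≤ x) (hx1 : x < 1) (n : ℕ) {a h : ℕ}
    (hah : a ≤ h + 1) : catchUpIter x n a h ≤ prophetValue x a h := by
  induction n generalizing a h with
  | zero =>
    rcases Nat.lt_or_ge h a with h1 | h1
    · obtain rfl : a = h + 1 := by omega
      simp [catchUpIter, prophetValue]; linarith
    · simpa [catchUpIter, h1.not_gt] using neg_le_prophetValue hx hx1 h1
  | succ n ih =>
    rcases Nat.lt_or_ge h a with h1 | h1
    · obtain rfl : a = h + 1 := by omega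
      simp [catchUpIter, prophetValue]; linarith
    · rw [catchUpIter_succ_of_le h1]
      refine max_le (neg_le_prophetValue hx hx1 h1) ?_
      rw [div_le_iff₀ (by linarith)]
      have h2 := ih (a := a + 1) (h := h) (by omega)
      have h3 := ih (a := a) (h := h + 1) (by omega)
      have h4 := prophetValue_step hx hx1 h1
      nlinarith [mul_le_mul_of_nonneg_left h2 hx]

/-- The value of the stopping problem of an attacker that is not ahead. -/
noncomputable def catchUp (x : ℝ) (a h : ℕ) : ℝ := ⨆ n, catchUpIter x n a h

theorem catchUp_of_lt {x : ℝ} {a h : ℕ} (hah : h < a) : catchUp x a h = x * h := by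
  simp [catchUp, catchUpIter_of_lt hah]

theorem bddAbove_catchUpIter {x : ℝ} (hx : 0 ≤ x) (hx1 : x < 1) (a h : ℕ) :
    BddAbove (Set.range fun n => catchUpIter x n a h) := by
  rcases Nat.lt_or_ge h a with h1 | h1
  · refine ⟨x * h, ?_⟩
    rintro _ ⟨n, rfl⟩
    exact (catchUpIter_of_lt h1 n).le
  · refine ⟨prophetValue x a h, ?_⟩
    rintro _ ⟨n, rfl⟩
    exact catchUpIter_le_prophetValue hx hx1 n (by omega)

theorem tendsto_catchUpIter {x : ℝ} (hx : 0 ≤ x) (hx1 : x < 1) (a h : ℕ) :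
    Tendsto (fun n => catchUpIter x n a h) atTop (nhds (catchUp x a h)) :=
  tendsto_atTop_ciSup (monotone_nat_of_le_succ fun n => catchUpIter_mono hx n a h)
    (bddAbove_catchUpIter hx hx1 a h)

theorem catchUpIter_le_catchUp {x : ℝ} (hx : 0 ≤ x) (hx1 : x < 1) (n a h : ℕ) :
    catchUpIter x n a h ≤ catchUp x a h := le_ciSup (bddAbove_catchUpIter hx hx1 a h) n

theorem neg_le_catchUp {x : ℝ} (hx : 0 ≤ x) (hx1 : x < 1) {a h : ℕ} (hah : a ≤ h) :
    -(a : ℝ) ≤ catchUp x a h :=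
  (neg_le_catchUpIter hah 0).trans (catchUpIter_le_catchUp hx hx1 0 a h)

theorem catchUp_le_prophetValue {x : ℝ} (hx : 0 ≤ x) (hx1 : x < 1) {a h : ℕ} (hah : a ≤ h + 1) :
    catchUp x a h ≤ prophetValue x a h :=
  ciSup_le fun n => catchUpIter_le_prophetValue hx hx1 n hah

theorem catchUp_eq {x : ℝ} (hx : 0 ≤ x) (hx1 : x < 1) {a h : ℕ} (hah : a ≤ h) :
    catchUp x a h = max (-(a : ℝ)) ((x * catchUp x (a + 1) h + catchUp x a (h + 1)) / (1 + x)) := by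
  have h1 := (tendsto_catchUpIter hx hx1 a h).comp (tendsto_add_atTop_nat 1)
  refine tendsto_nhds_unique h1 ?_
  simp only [Function.comp_def, catchUpIter_succ_of_le hah]
  exact tendsto_const_nhds.max ((((tendsto_catchUpIter hx hx1 (a + 1) h).const_mul x).add
    (tendsto_catchUpIter hx hx1 a (h + 1))).div_const _)

theorem catchUp_step {x : ℝ} (hx : 0 ≤ x) (hx1 : x < 1) {a h : ℕ} (hah : a ≤ h) :
    x * catchUp x (a + 1) h + catchUp x a (h + 1) ≤ (1 + x) * catchUp x a h := by
  have := le_max_right (-(a : ℝ)) ((x * catchUp x (a + 1) h + catchUp x a (h + 1)) / (1 + x))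
  rw [← catchUp_eq hx hx1 hah, div_le_iff₀ (by linarith)] at this
  linarith

theorem catchUp_step_eq {x : ℝ} (hx : 0 ≤ x) (hx1 : x < 1) {a h : ℕ} (hah : a ≤ h)
    (hlt : -(a : ℝ) < catchUp x a h) :
    x * catchUp x (a + 1) h + catchUp x a (h + 1) = (1 + x) * catchUp x a h := by
  have h1 := catchUp_eq hx hx1 hah
  rcases max_choice (-(a : ℝ)) ((x * catchUp x (a + 1) h + catchUp x a (h + 1)) / (1 + x))
    with h2 | h2
  · rw [h2] at h1; linarith
  · rw [h2, eq_div_iff (by linarith)] at h1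
    linarith

/-- Use the same strategy from both starting points. The additional pair of blocks brings `x` if the
attacker gets ahead and costs `1` if it does not, that is `-1 + (1 + x) p`, and the probability `p`
of getting ahead is at most `x ^ (h + 1 - a)`. -/
theorem catchUpIter_diag {x : ℝ} (hx : 0 ≤ x) (n : ℕ) {a h : ℕ} (hah : a ≤ h + 1) :
    catchUpIter x n (a + 1) (h + 1) ≤ catchUpIter x n a h - 1 + (1 + x) * x ^ (h + 1 - a) := by
  induction n generalizing a h with
  | zero =>
    rcases Nat.lt_or_ge h a with h1 | h1
    · obtain rfl : a = h + 1 := by omega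
      simp [catchUpIter]; linarith
    · have : 0 ≤ (1 + x) * x ^ (h + 1 - a) := by positivity
      simp [catchUpIter, h1.not_gt]; linarith
  | succ n ih =>
    rcases Nat.lt_or_ge h a with h1 | h1
    · obtain rfl : a = h + 1 := by omega
      simp [catchUpIter]; linarith
    · obtain ⟨d, rfl⟩ := Nat.exists_eq_add_of_le h1
      rw [catchUpIter_succ_of_le h1, catchUpIter_succ_of_le (by omega)]
      have h2 := ih (a := a + 1) (h := a + d) (by omega)
      have h3 := ih (a := a) (h := a + d + 1) (by omega)
      have e1 : a + d + 1 - (a + 1) = d := by omega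
      have e2 : a + d + 1 + 1 - a = d + 2 := by omega
      have e3 : a + d + 1 - a = d + 1 := by omega
      rw [e1] at h2
      rw [e2] at h3
      rw [e3]
      have h0 : 0 ≤ (1 + x) * x ^ (d + 1) := by positivity
      have h4 := le_max_left (-(a : ℝ))
        ((x * catchUpIter x n (a + 1) (a + d) + catchUpIter x n a (a + d + 1)) / (1 + x))
      have h5 := le_max_right (-(a : ℝ))
        ((x * catchUpIter x n (a + 1) (a + d) + catchUpIter x n a (a + d + 1)) / (1 + x))
      refine max_le (by push_cast; linarith) ?_
      refine le_trans ?_ (add_le_add_left (sub_le_sub_right h5 1) _)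
      have hx0 : 0 < 1 + x := by linarith
      rw [div_le_iff₀ hx0, add_mul, sub_mul, div_mul_cancel₀ _ hx0.ne']
      have h6 := mul_le_mul_of_nonneg_left h2 hx
      have e : (1 + x) * x ^ (d + 1) * (1 + x)
        = x * ((1 + x) * x ^ d) + (1 + x) * x ^ (d + 2) := by ring
      rw [e]
      linarith

theorem catchUp_diag {x : ℝ} (hx : 0 ≤ x) (hx1 : x < 1) {a h : ℕ} (hah : a ≤ h + 1) :
    catchUp x (a + 1) (h + 1) ≤ catchUp x a h - 1 + (1 + x) * x ^ (h + 1 - a) :=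
  le_of_tendsto_of_tendsto' (tendsto_catchUpIter hx hx1 _ _)
    (((tendsto_catchUpIter hx hx1 a h).sub_const 1).add_const _)
    fun n => catchUpIter_diag hx n hah

/-- For `x ≤ 1 / 2` the diagonal increment is at most `-1 + (1 + x) * x < 0`, so the first tie is
the most favourable one. -/
theorem catchUp_tie_le {x : ℝ} (hx : 0 ≤ x) (hx1 : x ≤ 1 / 2) (k : ℕ) :
    catchUp x (k + 1) (k + 1) ≤ catchUp x 1 1 := by
  induction k with
  | zero => rfl
  | succ k ih =>
    have := catchUp_diag hx (by linarith) (a := k + 1) (h := k + 1) (by omega)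
    rw [show k + 1 + 1 - (k + 1) = 1 by omega] at this
    nlinarith

theorem catchUp_behind_le {x : ℝ} (hx : 0 ≤ x) (hx1 : x ≤ 1 / 2) (k : ℕ) :
    catchUp x (k + 1) (k + 2) ≤ catchUp x 1 2 := by
  induction k with
  | zero => rfl
  | succ k ih =>
    have := catchUp_diag hx (by linarith) (a := k + 1) (h := k + 2) (by omega)
    rw [show k + 2 + 1 - (k + 1) = 2 by omega] at this
    have hx2 : x ^ 2 ≤ 1 / 4 := by nlinarith
    nlinarith [sq_nonneg x]

theorem catchUp_nonpos {x : ℝ} (hx : 0 ≤ x) (hx1 : x ≤ 1 / 2) (h11 : catchUp x 1 1 ≤ 0) {a h : ℕ}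
    (hah : a ≤ h) (hh : 1 ≤ h) : catchUp x a h ≤ 0 := by
  have hx1' : x < 1 := by linarith
  refine ciSup_le fun n => ?_
  induction n generalizing a h with
  | zero => simp [catchUpIter, hah.not_gt]
  | succ n ih =>
    rcases hah.eq_or_lt with rfl | h1
    · obtain ⟨k, rfl⟩ := Nat.exists_eq_add_of_le' hh
      exact (catchUpIter_le_catchUp hx hx1' _ _ _).trans ((catchUp_tie_le hx hx1 k).trans h11)
    · rw [catchUpIter_succ_of_le hah]
      refine max_le (by simp) (div_nonpos_of_nonpos_of_nonneg ?_ (by linarith))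
      have h2 := ih (a := a + 1) (h := h) h1 hh
      have h3 := ih (a := a) (h := h + 1) (by omega) (by omega)
      nlinarith

/-- The comparison is inherited along the iteration except where one attacker block gives a lead
from `(a, h)` but only a tie from `(a, h + 1)`. There a tie is worth at most `0`, and a lead at
least `0`. -/
theorem catchUp_antitone {x : ℝ} (hx : 0 ≤ x) (hx1 : x ≤ 1 / 2) (h11 : catchUp x 1 1 ≤ 0) {a h : ℕ}
    (hah : a ≤ h) : catchUp x a (h + 1) ≤ catchUp x a h := by
  have hx1' : x < 1 := by linarith
  refine le_of_tendsto_of_tendsto' (tendsto_catchUpIter hx hx1' _ _)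
    (tendsto_catchUpIter hx hx1' _ _) fun n => ?_
  induction n generalizing a h with
  | zero => simp [catchUpIter, hah.not_gt, show ¬ h + 1 < a by omega]
  | succ n ih =>
    rw [catchUpIter_succ_of_le hah, catchUpIter_succ_of_le (by omega)]
    have h3 := ih (a := a) (h := h + 1) (by omega)
    have h2 : catchUpIter x n (a + 1) (h + 1) ≤ catchUpIter x n (a + 1) h := by
      rcases hah.eq_or_lt with rfl | h1
      · rw [catchUpIter_of_lt (Nat.lt_succ_self a)]
        have := (catchUpIter_le_catchUp hx hx1' n (a + 1) (a + 1)).trans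
          (catchUp_nonpos hx hx1 h11 le_rfl (by omega))
        have : 0 ≤ x * a := by positivity
        linarith
      · exact ih h1
    gcongr

/-! ### The potential that certifies honest mining -/

theorem blockMean_eq_div {y : ℝ} (hy : 0 ≤ y) (γ : ℝ) (f : Block → ℝ) :
    blockMean (y / (1 + y)) γ f
      = (y * f .attacker + (1 - γ) * f .honestOwn + γ * f .honestSplit) / (1 + y) := by
  have : 1 + y ≠ 0 := by linarith
  unfold blockMean
  field_simp
  ring

/-- The value of a lead of the attacker: wait until the lead is `1`, then override. -/
noncomputable def leadValue (y : ℝ) (a h : ℕ) : ℝ := y * (h + ((a : ℝ) - h - 1) * (1 - y)⁻¹)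

/-- The value of a tie, given the values behind a tie; a relevant tie may be matched. -/
noncomputable def tieValue (x y γ : ℝ) : Fork → ℕ → ℝ
  | .relevant, k => max (catchUp x k k) (((y + γ) * y * k + (1 - γ) * catchUp x k (k + 1)) / (1 + y))
  | _, k => catchUp x k k

/-- The lead part uses the actual odds `y`, the catch-up part the larger odds `x`. An upper bound
suffices for the certificate, and this way the hypothesis at `x` serves every `y ≤ x`. -/
noncomputable def stateValue (x y γ : ℝ) (s : State) : ℝ :=
  if s.h < s.a then leadValue y s.a s.h
  else if s.a = s.h then tieValue x y γ s.fork s.h else catchUp x s.a s.h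

/-- The labels and lengths that occur along a chain. -/
def Reachable (s : State) : Prop := (s.fork = .active → s.h < s.a) ∧ 1 ≤ s.a + s.h

theorem reachable_initial (b : Block) : Reachable (initial b) := by
  cases b <;> simp [Reachable, initial]

theorem Reachable.step {s : State} (hs : Reachable s) {x : Action} (hx : Feasible s x) (b : Block) :
    Reachable (step s x b) := by
  obtain ⟨a, h, f⟩ := s
  cases x
  · exact reachable_initial b
  · simp only [Feasible] at hx
    cases b <;> (simp [Reachable, SelfishMining.step]; try omega)
  · simp only [Feasible] at hx
    cases b <;> simp [Reachable, SelfishMining.step, race] <;> omega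
  · obtain ⟨h1, h2⟩ := hs
    cases f <;> cases b <;> simp [Reachable, SelfishMining.step, race, extend] at h1 h2 ⊢ <;> omega

theorem reachable_chain {π : Policy} (hπ : ∀ s, Feasible s (π s)) (ω : ℕ → Block) (t : ℕ) :
    Reachable (chain π ω t) := by
  induction t with
  | zero => exact reachable_initial _
  | succ t ih => exact ih.step (hπ _) _

/-- Parameters `x = α / (1 - α)` and `y = α' / (1 - α')` with `α' ≤ α ≤ 1 / 3` for which withholding
the first block does not pay at `α`. -/
structure Unprofitable (x y γ : ℝ) : Prop where
  y_nonneg : 0 ≤ y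
  y_le : y ≤ x
  x_pos : 0 < x
  x_le : x ≤ 1 / 2
  γ_nonneg : 0 ≤ γ
  γ_le : γ ≤ 1
  -- From `(1, 0)`, of value `0`, withholding leads to `(2, 0)`, worth `x / (1 - x)`, or to a
  -- matched tie worth `((x + γ) * x + (1 - γ) * catchUp x 1 2) / (1 + x)`. The weighted sum is
  -- required to be nonpositive.
  withhold : (x + γ) * x + (1 - γ) * catchUp x 1 2 ≤ -((1 + x) * (x ^ 2 / (1 - x)))

namespace Unprofitable

variable {x y γ : ℝ}

theorem catchUp_one_two_nonpos (H : Unprofitable x y γ) : catchUp x 1 2 ≤ 0 := by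
  obtain ⟨_, _, hx, hx1, hγ, hγ1, hw⟩ := H
  by_contra! hc
  have h1 : 0 ≤ (1 + x) * (x ^ 2 / (1 - x)) := by
    have : 0 ≤ 1 - x := by linarith
    positivity
  have h2 : 0 ≤ (1 - γ) * catchUp x 1 2 := mul_nonneg (by linarith) hc.le
  have h3 : 0 < (x + γ) * x := by positivity
  linarith

theorem div_le_div (H : Unprofitable x y γ) : y ^ 2 / (1 - y) ≤ x ^ 2 / (1 - x) := by
  obtain ⟨hy, hyx, hx, hx1, -⟩ := H
  exact div_le_div₀ (by positivity) (by gcongr) (by linarith) (by linarith)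

theorem withhold_of_le (H : Unprofitable x y γ) :
    (y + γ) * y + (1 - γ) * catchUp x 1 2 ≤ -((1 + y) * (y ^ 2 / (1 - y))) := by
  have hd := H.div_le_div
  obtain ⟨hy, hyx, hx, hx1, hγ, hγ1, hw⟩ := H
  have h1 : (y + γ) * y ≤ (x + γ) * x := by gcongr
  have h2 : 0 ≤ x ^ 2 / (1 - x) := div_nonneg (sq_nonneg _) (by linarith)
  have h3 : (1 + y) * (y ^ 2 / (1 - y)) ≤ (1 + x) * (x ^ 2 / (1 - x)) :=
    mul_le_mul (by linarith) hd (div_nonneg (sq_nonneg _) (by linarith)) (by linarith)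
  linarith

/-- Waiting at the tie amounts to matching with `γ = 0`. This is no better than matching, since
winning the split is worth `x` and losing it `catchUp x 1 2 ≤ 0`. -/
theorem catchUp_one_one_le (H : Unprofitable x y γ) : catchUp x 1 1 ≤ -(y ^ 2 / (1 - y)) := by
  have hd := H.div_le_div
  have hc := H.catchUp_one_two_nonpos
  obtain ⟨hy, hyx, hx, hx1, hγ, hγ1, hw⟩ := H
  refine le_trans ?_ (neg_le_neg hd)
  rw [catchUp_eq hx.le (by linarith) le_rfl, catchUp_of_lt (by norm_num)]
  refine max_le ?_ ?_
  · rw [neg_le_neg_iff, div_le_iff₀ (by linarith)]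
    push_cast
    nlinarith
  · rw [div_le_iff₀ (by linarith)]
    push_cast
    nlinarith [mul_nonneg hγ hx.le, mul_nonneg hγ (neg_nonneg.2 hc)]

theorem catchUp_one_one_nonpos (H : Unprofitable x y γ) : catchUp x 1 1 ≤ 0 :=
  H.catchUp_one_one_le.trans
    (neg_nonpos.2 (div_nonneg (sq_nonneg _) (by linarith [H.y_le, H.x_le])))

theorem catchUp_nonpos (H : Unprofitable x y γ) {a h : ℕ} (hah : a ≤ h) (hh : 1 ≤ h) :
    catchUp x a h ≤ 0 :=
  SelfishMining.catchUp_nonpos H.x_pos.le H.x_le H.catchUp_one_one_nonpos hah hh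

theorem catchUp_antitone (H : Unprofitable x y γ) {a h : ℕ} (hah : a ≤ h) :
    catchUp x a (h + 1) ≤ catchUp x a h :=
  SelfishMining.catchUp_antitone H.x_pos.le H.x_le H.catchUp_one_one_nonpos hah

/-- An honest block does not raise the value, by antitonicity. So if an attacker block raises it,
lowering its weight from `x` to `y` only helps; if not, neither outcome raises the value. -/
theorem catchUp_step_le (H : Unprofitable x y γ) {a h : ℕ} (hah : a ≤ h) :
    y * catchUp x (a + 1) h + catchUp x a (h + 1) ≤ (1 + y) * catchUp x a h := by
  have h1 := catchUp_step H.x_pos.le (by linarith [H.x_le]) hah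
  have h2 := H.catchUp_antitone hah
  have hy := H.y_nonneg
  have hyx := H.y_le
  rcases le_total (catchUp x (a + 1) h) (catchUp x a h) with h3 | h3
  · nlinarith
  · nlinarith [mul_le_mul_of_nonneg_right hyx (sub_nonneg.2 h3)]

theorem inv_mul (H : Unprofitable x y γ) : (1 - y)⁻¹ * (1 - y) = 1 :=
  inv_mul_cancel₀ (by linarith [H.y_le, H.x_le])

theorem leadValue_harmonic (H : Unprofitable x y γ) (a h : ℕ) :
    y * leadValue y (a + 1) h + leadValue y a (h + 1) = (1 + y) * leadValue y a h := by
  have := H.inv_mul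
  unfold leadValue
  push_cast
  linear_combination -y * this

theorem one_le_inv (H : Unprofitable x y γ) : 1 ≤ (1 - y)⁻¹ :=
  (one_le_inv₀ (by linarith [H.y_le, H.x_le])).2 (by linarith [H.y_nonneg])

/-- Here `leadValue` is extended linearly to lead zero. At the first tie the bound is the inequality
`withhold`; later ties follow from monotonicity along the diagonal. It makes the harmonic function
`leadValue` an upper bound also when a lead is lost. -/
theorem tieValue_le (H : Unprofitable x y γ) (f : Fork) (k : ℕ) :
    tieValue x y γ f (k + 1) ≤ leadValue y (k + 1) (k + 1) := by
  have h0 := H.inv_mul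
  have h1 := H.catchUp_one_one_le
  have h2 := catchUp_tie_le H.x_pos.le H.x_le k
  have h3 := catchUp_behind_le H.x_pos.le H.x_le k
  have h4 := H.withhold_of_le
  have hy := H.y_nonneg
  have hyk : 0 ≤ y * k := by positivity
  have e : leadValue y (k + 1) (k + 1) = y * k - y ^ 2 / (1 - y) := by
    unfold leadValue
    rw [div_eq_mul_inv]
    push_cast
    linear_combination -y * h0
  have h5 : catchUp x (k + 1) (k + 1) ≤ leadValue y (k + 1) (k + 1) := by rw [e]; linarith
  cases f
  · exact h5
  · refine max_le h5 ?_
    rw [div_le_iff₀ (by linarith), e]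
    have h6 : (1 - γ) * catchUp x (k + 1) (k + 2) ≤ (1 - γ) * catchUp x 1 2 :=
      mul_le_mul_of_nonneg_left h3 (by linarith [H.γ_le])
    have h7 : (y + γ) * (y * k) ≤ (1 + y) * (y * k) :=
      mul_le_mul_of_nonneg_right (by linarith [H.γ_le]) hyk
    push_cast
    nlinarith
  · exact h5

theorem stateValue_of_lt {s : State} (h : s.h < s.a) : stateValue x y γ s = leadValue y s.a s.h := by
  simp [stateValue, h]

theorem stateValue_of_gt {s : State} (h : s.a < s.h) : stateValue x y γ s = catchUp x s.a s.h := by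
  simp [stateValue, h.not_gt, h.ne]

theorem stateValue_tie (k : ℕ) (f : Fork) : stateValue x y γ ⟨k, k, f⟩ = tieValue x y γ f k := by
  simp [stateValue]

theorem stateValue_irrelevant {a h : ℕ} (hah : a ≤ h) :
    stateValue x y γ ⟨a, h, .irrelevant⟩ = catchUp x a h := by
  rcases hah.eq_or_lt with rfl | h1
  · simp [stateValue, tieValue]
  · exact stateValue_of_gt h1

theorem stateValue_le_leadValue (H : Unprofitable x y γ) {a h : ℕ} (f : Fork) (h1 : 1 ≤ h)
    (h2 : h ≤ a) : stateValue x y γ ⟨a, h, f⟩ ≤ leadValue y a h := by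
  rcases h2.eq_or_lt with rfl | h2
  · obtain ⟨k, rfl⟩ := Nat.exists_eq_add_of_le' h1
    rw [stateValue_tie]
    exact H.tieValue_le f k
  · exact (stateValue_of_lt h2).le

theorem catchUp_le_tieValue (f : Fork) (k : ℕ) : catchUp x k k ≤ tieValue x y γ f k := by
  cases f
  · exact le_rfl
  · exact le_max_left _ _
  · exact le_rfl

theorem catchUp_le_stateValue {a h : ℕ} (f : Fork) (hah : a ≤ h) :
    catchUp x a h ≤ stateValue x y γ ⟨a, h, f⟩ := by
  rcases hah.eq_or_lt with rfl | h1
  · rw [stateValue_tie]; exact catchUp_le_tieValue f a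
  · exact (stateValue_of_gt (s := ⟨a, h, f⟩) h1).ge

theorem neg_le_stateValue (H : Unprofitable x y γ) (s : State) : -(s.a : ℝ) ≤ stateValue x y γ s := by
  obtain ⟨a, h, f⟩ := s
  rcases Nat.lt_or_ge h a with h1 | h1
  · rw [stateValue_of_lt h1]
    have h2 : (h : ℝ) + 1 ≤ a := by exact_mod_cast h1
    have h3 : 0 ≤ leadValue y a h := by
      have := H.one_le_inv
      have := H.y_nonneg
      have : (0 : ℝ) ≤ (a : ℝ) - h - 1 := by linarith
      unfold leadValue
      positivity
    have : (0 : ℝ) ≤ a := by positivity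
    simp only
    linarith
  · exact (neg_le_catchUp H.x_pos.le (by linarith [H.x_le]) h1).trans (catchUp_le_stateValue f h1)

theorem stateValue_le (H : Unprofitable x y γ) {s : State} (hs : Reachable s) :
    stateValue x y γ s ≤ s.a + s.h := by
  obtain ⟨a, h, f⟩ := s
  have hs := hs.2
  have hy := H.y_nonneg
  have hy2 : y ≤ 1 / 2 := H.y_le.trans H.x_le
  have h0 : (0 : ℝ) ≤ a := by positivity
  have h0' : (0 : ℝ) ≤ h := by positivity
  rcases Nat.lt_or_ge h a with h1 | h1
  · rw [stateValue_of_lt h1]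
    have h2 : (h : ℝ) + 1 ≤ a := by exact_mod_cast h1
    have h3 : y * (1 - y)⁻¹ ≤ 1 := by
      rw [mul_inv_le_iff₀ (by linarith)]; linarith
    unfold leadValue
    simp only at *
    nlinarith
  · have hh : 1 ≤ h := by simp only at hs; omega
    have hneg : ∀ a' h', a' ≤ h' → 1 ≤ h' → catchUp x a' h' ≤ (a : ℝ) + h :=
      fun a' h' h2 h3 => (H.catchUp_nonpos h2 h3).trans (by positivity)
    rcases h1.eq_or_lt with rfl | h1
    · rw [stateValue_tie]
      cases f
      · exact hneg _ _ le_rfl hh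
      · refine max_le (hneg _ _ le_rfl hh) ?_
        rw [div_le_iff₀ (by linarith)]
        have h4 := H.catchUp_nonpos (a := a) (h := a + 1) (by omega) (by omega)
        have hγ := H.γ_le
        have h5 : (1 - γ) * catchUp x a (a + 1) ≤ 0 :=
          mul_nonpos_of_nonneg_of_nonpos (by linarith) h4
        have h6 : (y + γ) * y * a ≤ (1 + y) * 1 * a :=
          mul_le_mul_of_nonneg_right (by nlinarith [H.γ_nonneg]) h0
        simp only
        nlinarith
      · exact hneg _ _ le_rfl hh
    · rw [stateValue_of_gt h1]
      exact hneg _ _ (le_of_lt h1) hh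

/-- The potential that certifies honest mining. -/
noncomputable def potential (x y γ : ℝ) (s : State) : ℝ := stateValue x y γ s + s.a - y * s.h

/-- This is the optimality inequality with gain zero. With a lead it reduces to harmonicity of
`leadValue` and its domination of the tie values; otherwise to the step inequality for `catchUp`, to
the second entry of `tieValue` for a match, and to `-a` as a lower bound for adopting. -/
theorem mean_reward_add_potential_le (H : Unprofitable x y γ) {s : State} (hs : Reachable s)
    {c : Action} (hc : Feasible s c) :
    blockMean (y / (1 + y)) γ (fun b => ((reward s c b).1 : ℝ) - y * (reward s c b).2
      + potential x y γ (step s c b)) ≤ potential x y γ s := by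
  have hy := H.y_nonneg
  have hγ := H.γ_nonneg
  have hγ1 : 0 ≤ 1 - γ := sub_nonneg.2 H.γ_le
  have ht := H.inv_mul
  have ht1 := H.one_le_inv
  rw [blockMean_eq_div hy, div_le_iff₀ (by linarith)]
  obtain ⟨a, h, f⟩ := s
  have h10 : ∀ f, stateValue x y γ ⟨1, 0, f⟩ = 0 := fun f => by
    rw [stateValue_of_lt (by norm_num)]; simp [leadValue]
  have h01 : ∀ f, stateValue x y γ ⟨0, 1, f⟩ ≤ 0 := fun f => by
    rw [stateValue_of_gt (by norm_num)]; exact H.catchUp_nonpos (by norm_num) le_rfl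
  have h01m : ∀ f, γ * stateValue x y γ ⟨0, 1, f⟩ ≤ 0 := fun f =>
    mul_nonpos_of_nonneg_of_nonpos hγ (h01 f)
  have hrace : h < a → y * stateValue x y γ ⟨a + 1, h, .active⟩
      + (1 - γ) * stateValue x y γ ⟨a, h + 1, .relevant⟩
      + γ * (y * h + stateValue x y γ ⟨a - h, 1, .relevant⟩) ≤ (1 + y) * stateValue x y γ ⟨a, h, f⟩ := by
    intro hah
    have e1 := H.leadValue_harmonic a h
    have e2 := H.stateValue_le_leadValue (a := a) (h := h + 1) .relevant (by omega) (by omega)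
    have e3 := H.stateValue_le_leadValue (a := a - h) (h := 1) .relevant (by omega) (by omega)
    -- Winning the split settles `h` orphaned honest blocks and leaves the same lead as losing it,
    -- so the two outcomes have equal lead value.
    have e4 : y * h + leadValue y (a - h) 1 = leadValue y a (h + 1) := by
      unfold leadValue
      rw [Nat.cast_sub hah.le]
      push_cast
      ring
    rw [stateValue_of_lt (s := ⟨a + 1, h, .active⟩) (Nat.lt_succ_of_lt hah),
      stateValue_of_lt (s := ⟨a, h, f⟩) hah]
    simp only
    have e5 := mul_le_mul_of_nonneg_left e2 hγ1
    have e6 := mul_le_mul_of_nonneg_left e3 hγ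
    have e7 : γ * (y * h) + γ * leadValue y (a - h) 1 = γ * leadValue y a (h + 1) := by
      rw [← mul_add, e4]
    linarith
  cases c
  · have h1 := H.neg_le_stateValue ⟨a, h, f⟩
    have h2 := h01 .irrelevant
    simp only [reward, step, initial, potential, h10] at h1 ⊢
    push_cast
    nlinarith
  · simp only [Feasible] at hc
    obtain ⟨d, rfl⟩ := Nat.exists_eq_add_of_lt hc
    have e1 : h + d + 1 - h = d + 1 := by omega
    have e2 : h + d + 1 - h - 1 = d := by omega
    have key : y * stateValue x y γ ⟨d + 1, 0, .irrelevant⟩ + stateValue x y γ ⟨d, 1, .relevant⟩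
        ≤ (1 + y) * (stateValue x y γ ⟨h + d + 1, h, f⟩ - y * h) := by
      rw [stateValue_of_lt (s := ⟨h + d + 1, h, f⟩) (by simp only; omega),
        stateValue_of_lt (s := ⟨d + 1, 0, .irrelevant⟩) (by simp)]
      have e3 : leadValue y (h + d + 1) h - y * h = leadValue y (d + 1) 0 := by
        unfold leadValue; push_cast; ring
      simp only
      rw [e3]
      rcases Nat.eq_zero_or_pos d with rfl | hd
      · have := h01 .relevant
        simp only [leadValue]
        push_cast
        linarith
      · have h3 := H.stateValue_le_leadValue (a := d) (h := 1) .relevant le_rfl hd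
        have h4 : leadValue y d 1 ≤ leadValue y (d + 1) 0 := by
          unfold leadValue
          push_cast
          have : y * 1 ≤ y * (1 - y)⁻¹ := by gcongr
          have : 0 ≤ y * (1 - y)⁻¹ := by positivity
          linarith
        linarith
    simp only [reward, step, potential, e1]
    push_cast
    linarith
  · simp only [Feasible] at hc
    obtain ⟨hah, rfl⟩ := hc
    have key : y * stateValue x y γ ⟨a + 1, h, .active⟩
        + (1 - γ) * stateValue x y γ ⟨a, h + 1, .relevant⟩
        + γ * (y * h + stateValue x y γ ⟨a - h, 1, .relevant⟩)
        ≤ (1 + y) * stateValue x y γ ⟨a, h, .relevant⟩ := by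
      rcases hah.eq_or_lt with rfl | hah
      · rw [stateValue_of_lt (s := ⟨h + 1, h, .active⟩) (Nat.lt_succ_self h), stateValue_tie,
          stateValue_of_gt (s := ⟨h, h + 1, .relevant⟩) (Nat.lt_succ_self h), Nat.sub_self]
        have h1 := h01m .relevant
        have h2 := le_max_right (catchUp x h h)
          (((y + γ) * y * h + (1 - γ) * catchUp x h (h + 1)) / (1 + y))
        rw [div_le_iff₀ (by linarith)] at h2
        have h3 : leadValue y (h + 1) h = y * h := by unfold leadValue; push_cast; ring
        simp only [tieValue, h3]
        nlinarith
      · exact hrace hah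
    simp only [reward, raceReward, step, race, potential, Nat.cast_sub hah]
    push_cast
    linarith
  · have hwait : f ≠ .active → y * stateValue x y γ ⟨a + 1, h, .irrelevant⟩
        + stateValue x y γ ⟨a, h + 1, .relevant⟩ ≤ (1 + y) * stateValue x y γ ⟨a, h, f⟩ := by
      intro _
      rcases Nat.lt_or_ge h a with hah | hah
      · have e1 := H.leadValue_harmonic a h
        have e2 := H.stateValue_le_leadValue (a := a) (h := h + 1) .relevant (by omega) (by omega)
        rw [stateValue_of_lt (s := ⟨a + 1, h, .irrelevant⟩) (Nat.lt_succ_of_lt hah),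
          stateValue_of_lt (s := ⟨a, h, f⟩) hah]
        simp only
        linarith
      · have h1 := H.catchUp_step_le hah
        have h2 := mul_le_mul_of_nonneg_left (catchUp_le_stateValue (x := x) (y := y) (γ := γ) f hah)
          (by linarith : 0 ≤ 1 + y)
        rw [stateValue_of_gt (s := ⟨a, h + 1, .relevant⟩) (Nat.lt_succ_of_le hah)]
        refine le_trans (add_le_add (mul_le_mul_of_nonneg_left ?_ hy) le_rfl) (h1.trans h2)
        rcases hah.eq_or_lt with rfl | hah
        · rw [stateValue_of_lt (s := ⟨a + 1, a, .irrelevant⟩) (Nat.lt_succ_self a),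
            catchUp_of_lt (Nat.lt_succ_self a)]
          have h3 : leadValue y (a + 1) a = y * a := by unfold leadValue; push_cast; ring
          simp only [h3]
          have := H.y_le
          gcongr
        · exact (stateValue_irrelevant hah).le
    cases f
    · have := hwait (by simp)
      simp only [reward, step, extend, potential]
      push_cast
      linarith
    · have := hwait (by simp)
      simp only [reward, step, extend, potential]
      push_cast
      linarith
    · have hah : h < a := hs.1 rfl
      have := hrace hah
      simp only [reward, raceReward, step, race, potential, Nat.cast_sub hah.le]
      push_cast
      linarith

end Unprofitable

/-! ### Moment bounds -/

/-- A Lyapunov function: it grows geometrically with the length of a race and contracts on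
average. -/
noncomputable def lyapunov (s : State) : ℝ := (3 / 2) ^ s.a * (7 / 10) ^ s.h

theorem lyapunov_nonneg (s : State) : 0 ≤ lyapunov s := by unfold lyapunov; positivity

theorem lyapunov_split_le {a h : ℕ} (hah : h ≤ a) (k : ℕ) :
    ((3 : ℝ) / 2) ^ (a - h) * (7 / 10) ^ k ≤ (3 / 2) ^ a * (7 / 10) ^ (h + k) := by
  obtain ⟨d, rfl⟩ := Nat.exists_eq_add_of_le hah
  have h1 : (1 : ℝ) ≤ (21 / 20) ^ h := one_le_pow₀ (by norm_num)
  have h2 : ((3 : ℝ) / 2) ^ (h + d) * (7 / 10) ^ (h + k)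
      = (21 / 20) ^ h * ((3 / 2) ^ d * (7 / 10) ^ k) := by
    rw [pow_add, pow_add, show (21 : ℝ) / 20 = 3 / 2 * (7 / 10) by norm_num, mul_pow]; ring
  rw [h2, Nat.add_sub_cancel_left]
  exact le_mul_of_one_le_left (by positivity) h1

/-- The mean factor of a waiting step is `(3 / 2 * y + 7 / 10) / (1 + y)`, which equals `29 / 30` at
`y = 1 / 2` and is smaller below. Removing matched pairs of blocks only decreases the function
because `3 / 2 * (7 / 10) = 21 / 20 > 1`. -/
theorem mean_lyapunov_le {y γ : ℝ} (hy : 0 ≤ y) (hy2 : y ≤ 1 / 2) (hγ : 0 ≤ γ) (hγ1 : γ ≤ 1)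
    {s : State} (hs : Reachable s) {c : Action} (hc : Feasible s c) :
    blockMean (y / (1 + y)) γ (fun b => lyapunov (step s c b)) ≤ 29 / 30 * lyapunov s + 1 := by
  rw [blockMean_eq_div hy, div_le_iff₀ (by linarith)]
  obtain ⟨a, h, f⟩ := s
  have hγ2 : 0 ≤ 1 - γ := by linarith
  have hmain : ∀ L : ℝ, 0 ≤ L → y * (L * (3 / 2)) + L * (7 / 10) ≤ (29 / 30 * L + 1) * (1 + y) := by
    intro L hL
    nlinarith [mul_nonneg hL (sub_nonneg.2 hy2)]
  have hwait : y * ((3 / 2 : ℝ) ^ (a + 1) * (7 / 10) ^ h) + (3 / 2) ^ a * (7 / 10) ^ (h + 1)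
      ≤ (29 / 30 * ((3 / 2) ^ a * (7 / 10) ^ h) + 1) * (1 + y) := by
    have := hmain ((3 / 2) ^ a * (7 / 10) ^ h) (by positivity)
    rw [pow_succ, pow_succ]
    linarith
  have hrace : h ≤ a → y * ((3 / 2 : ℝ) ^ (a + 1) * (7 / 10) ^ h)
      + (1 - γ) * ((3 / 2) ^ a * (7 / 10) ^ (h + 1)) + γ * ((3 / 2) ^ (a - h) * (7 / 10) ^ 1)
      ≤ (29 / 30 * ((3 / 2) ^ a * (7 / 10) ^ h) + 1) * (1 + y) := by
    intro hah
    have := mul_le_mul_of_nonneg_left (lyapunov_split_le hah 1) hγ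
    linarith
  cases c
  · have : 0 ≤ (3 / 2 : ℝ) ^ a * (7 / 10) ^ h := by positivity
    simp only [lyapunov, step, initial]
    nlinarith
  · simp only [Feasible] at hc
    obtain ⟨d, rfl⟩ := Nat.exists_eq_add_of_lt hc
    have e1 : h + d + 1 - h = d + 1 := by omega
    have h1 := lyapunov_split_le (a := h + d + 1) (h := h) (by omega) 0
    rw [e1] at h1
    have h2 := hmain ((3 / 2) ^ d) (by positivity)
    have h3 : (3 / 2 : ℝ) ^ d ≤ (3 / 2) ^ (d + 1) := pow_le_pow_right₀ (by norm_num) (by omega)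
    simp only [lyapunov, step, e1, Nat.add_sub_cancel]
    simp only [pow_zero, mul_one, add_zero, pow_one] at *
    rw [pow_succ (3 / 2 : ℝ) d] at *
    nlinarith
  · have := hrace hc.1
    simp only [lyapunov, step, race]
    linarith
  · cases f
    · simp only [lyapunov, step, extend]
      linarith
    · simp only [lyapunov, step, extend]
      linarith
    · have := hrace (hs.1 rfl).le
      simp only [lyapunov, step, race]
      linarith

/-- The bound `30` is the fixed point of `L ↦ 29 / 30 * L + 1`. -/
theorem integral_lyapunov_le (α γ : unitInterval) {y : ℝ} (hy : 0 ≤ y) (hy2 : y ≤ 1 / 2)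
    (hα : (α : ℝ) = y / (1 + y)) {π : Policy} (hπ : ∀ s, Feasible s (π s)) (t : ℕ) :
    ∫ ω, lyapunov (chain π ω t) ∂(blocksLaw α γ) ≤ 30 := by
  induction t with
  | zero =>
    have h1 : ∀ ω, lyapunov (chain π ω 0) ≤ 30 := by
      intro ω
      simp only [chain]
      cases ω 0 <;> norm_num [initial, lyapunov]
    refine (integral_mono (integrable_chain α γ π lyapunov 0) (integrable_const 30) h1).trans ?_
    simp
  | succ t ih =>
    have h1 := integral_next α γ π t (fun s b => lyapunov (step s (π s) b))
    have h2 : ∫ ω, blockMean α γ (fun b => lyapunov (step (chain π ω t) (π (chain π ω t)) b))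
        ∂(blocksLaw α γ) ≤ ∫ ω, (29 / 30 * lyapunov (chain π ω t) + 1) ∂(blocksLaw α γ) := by
      refine integral_mono (integrable_chain α γ π
        (fun s => blockMean α γ (fun b => lyapunov (step s (π s) b))) t)
        (((integrable_chain α γ π lyapunov t).const_mul _).add (integrable_const 1)) fun ω => ?_
      simp only [hα]
      exact mean_lyapunov_le hy hy2 γ.2.1 γ.2.2 (reachable_chain hπ ω t) (hπ _)
    rw [integral_add ((integrable_chain α γ π lyapunov t).const_mul _) (integrable_const 1),
      integral_const_mul] at h2
    simp only [integral_const, probReal_univ, smul_eq_mul, mul_one] at h2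
    simp only [chain]
    rw [h1]
    linarith

/-- When `h ≤ a` the function is at least `(21 / 20) ^ a`, which beats any square. At deficit `d` it
is `(21 / 20) ^ h * (2 / 3) ^ d`, and `(1 / 4) ^ d ≤ (2 / 3) ^ d` absorbs the squared factor `(1 /
2) ^ d`. -/
theorem exists_sq_le_lyapunov : ∃ C : ℝ, 0 ≤ C ∧ ∀ s : State,
    (s.h ≤ s.a → (2 * (s.a : ℝ) + 1) ^ 2 ≤ C * lyapunov s) ∧
    (s.a < s.h → (1 + 2 * s.h * (1 / 2 : ℝ) ^ (s.h - s.a)) ^ 2 ≤ C * (1 + lyapunov s)) := by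
  have h1 : Tendsto (fun n : ℕ => (n : ℝ) ^ 2 * (20 / 21 : ℝ) ^ n) atTop (nhds 0) :=
    tendsto_pow_const_mul_const_pow_of_abs_lt_one 2 (by rw [abs_of_pos] <;> norm_num)
  obtain ⟨C, hC⟩ := h1.bddAbove_range
  have hC' : ∀ n : ℕ, (n : ℝ) ^ 2 ≤ C * (21 / 20) ^ n := by
    intro n
    have h2 : (n : ℝ) ^ 2 * (20 / 21 : ℝ) ^ n ≤ C := hC ⟨n, rfl⟩
    have h3 := mul_le_mul_of_nonneg_right h2 (by positivity : (0 : ℝ) ≤ (21 / 20) ^ n)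
    rwa [mul_assoc, ← mul_pow, show (20 / 21 : ℝ) * (21 / 20) = 1 by norm_num, one_pow, mul_one] at h3
  have hC0 : 0 ≤ C := by simpa using hC' 0
  refine ⟨8 * C + 2, by positivity, fun s => ⟨fun hs => ?_, fun hs => ?_⟩⟩
  · have h2 : (21 / 20 : ℝ) ^ s.a ≤ lyapunov s := by
      unfold lyapunov
      rw [show (21 : ℝ) / 20 = 3 / 2 * (7 / 10) by norm_num, mul_pow]
      exact mul_le_mul_of_nonneg_left
        (pow_le_pow_of_le_one (by norm_num) (by norm_num) hs) (by positivity)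
    have h3 : (1 : ℝ) ≤ (21 / 20) ^ s.a := one_le_pow₀ (by norm_num)
    have h4 := hC' s.a
    have h5 := mul_le_mul_of_nonneg_left h2 (by positivity : 0 ≤ 8 * C + 2)
    nlinarith [sq_nonneg (2 * (s.a : ℝ) - 1)]
  · obtain ⟨a, h, f⟩ := s
    obtain ⟨d, rfl⟩ := Nat.exists_eq_add_of_le (show a ≤ h from le_of_lt hs)
    have e : a + d - a = d := by omega
    simp only [e]
    set u : ℝ := (1 / 2) ^ d with hu
    have hu2 : (21 / 20 : ℝ) ^ (a + d) * u ^ 2 ≤ lyapunov ⟨a, a + d, f⟩ := by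
      have h2 : u ^ 2 ≤ (2 / 3) ^ d := by
        rw [hu, ← pow_mul, mul_comm, pow_mul]
        exact pow_le_pow_left₀ (by norm_num) (by norm_num) _
      have h3 : lyapunov ⟨a, a + d, f⟩ = (21 / 20 : ℝ) ^ (a + d) * (2 / 3) ^ d := by
        simp only [lyapunov]
        rw [pow_add (21 / 20 : ℝ), mul_assoc, ← mul_pow, pow_add, ← mul_assoc, ← mul_pow]
        norm_num
      rw [h3]
      gcongr
    have h4 := mul_le_mul_of_nonneg_right (hC' (a + d)) (sq_nonneg u)
    have h5 := mul_le_mul_of_nonneg_left hu2 hC0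
    have h6 := lyapunov_nonneg ⟨a, a + d, f⟩
    nlinarith [sq_nonneg (1 - 2 * ((a + d : ℕ) : ℝ) * u)]

theorem sum_Icc_sub (φ : ℕ → ℝ) (N : ℕ) :
    ∑ t ∈ Finset.Icc 1 N, (φ (t + 1) - φ t) = φ (N + 1) - φ 1 := by
  induction N with
  | zero => simp
  | succ N ih => rw [Finset.sum_Icc_succ_top (by omega), ih]; ring

theorem abs_sub_blockMean_le (α γ : unitInterval) {f : Block → ℝ} {c B : ℝ}
    (h : ∀ b, |f b - c| ≤ B) (b : Block) : |f b - blockMean α γ f| ≤ 2 * B := by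
  have h1 : blockMean α γ f ≤ c + B := by
    rw [← blockMean_const α γ (c + B)]
    exact blockMean_mono α γ fun b => by linarith [(abs_le.1 (h b)).2]
  have h2 : c - B ≤ blockMean α γ f := by
    rw [← blockMean_const α γ (c - B)]
    exact blockMean_mono α γ fun b => by linarith [(abs_le.1 (h b)).1]
  have h3 := abs_le.1 (h b)
  exact abs_le.2 ⟨by linarith, by linarith⟩

/-- Strong law for a bounded function along the chain. -/
theorem ae_tendsto_average_chain_of_bounded (α γ : unitInterval) (π : Policy)
    (f : State → Block → ℝ) (B : ℝ) (hB : ∀ t ω b, |f (chain π ω t) b| ≤ B) :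
    ∀ᵐ ω ∂(blocksLaw α γ), Tendsto (fun N : ℕ => (∑ t ∈ Finset.Icc 1 N,
      (f (chain π ω t) (ω (t + 1)) - blockMean α γ (f (chain π ω t)))) / N) atTop (nhds 0) := by
  refine ae_tendsto_average_chain α γ π f ((2 * B) ^ 2) fun t => ?_
  have hi := (memLp_chain_block α γ π (fun s b => f s b - blockMean α γ (f s)) t (t + 1)
    2).integrable_sq
  refine (integral_mono hi (integrable_const ((2 * B) ^ 2)) fun ω => ?_).trans (by simp)
  refine sq_le_sq' ?_ ?_ <;>
  · have := abs_le.1 (abs_sub_blockMean_le α γ (c := 0) (f := f (chain π ω t)) (B := B)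
      (by simpa using hB t ω) (ω (t + 1)))
    linarith

/-! ### Growth of the public chain and waiting times -/

/-- The indicator of a block of the honest network. -/
def isHonest : Block → ℝ
  | .attacker => 0
  | _ => 1

theorem abs_isHonest_le (b : Block) : |isHonest b| ≤ 1 := by cases b <;> simp [isHonest]

theorem blockMean_isHonest (α γ : ℝ) : blockMean α γ isHonest = 1 - α := by
  simp [blockMean, isHonest]; ring

theorem ae_tendsto_average_isHonest (α γ : unitInterval) :
    ∀ᵐ ω ∂(blocksLaw α γ), Tendsto (fun N : ℕ => (∑ t ∈ Finset.Icc 1 N,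
      (isHonest (ω (t + 1)) - (1 - α))) / N) atTop (nhds 0) := by
  simpa only [blockMean_isHonest] using ae_tendsto_average_chain_of_bounded α γ honest
    (fun _ => isHonest) 1 (fun _ _ => abs_isHonest_le)

/-- Every honest block lengthens the public chain. -/
theorem length_le {s : State} {c : Action} (hc : Feasible s c) (b : Block) :
    (s.h : ℝ) + isHonest b ≤ (reward s c b).1 + (reward s c b).2 + (step s c b).h := by
  obtain ⟨a, h, f⟩ := s
  cases c
  · cases b <;> simp [reward, step, initial, isHonest]
  · cases b <;> simp [reward, step, isHonest]
  · cases b <;> simp [reward, raceReward, step, race, isHonest]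
  · cases f <;> cases b <;> simp [reward, raceReward, step, race, extend, isHonest]

/-- Adopting and overriding reset the honest chain, and matching needs `h ≤ a`. Only waiting while
behind can leave a long honest chain, so at the other times the unsettled blocks are controlled. -/
theorem length_step_le {s : State} {c : Action} (hc : Feasible s c) (hw : c ≠ .wait) (b : Block) :
    (step s c b).h ≤ 1 + if s.h ≤ s.a then s.h else 0 := by
  obtain ⟨a, h, f⟩ := s
  cases c
  · cases b <;> simp [step, initial]
  · cases b <;> simp [step]
  · simp only [Feasible] at hc
    cases b <;> simp [step, race, hc.1]
  · exact absurd rfl hw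

theorem measurable_waitingTime (π : Policy) (t : ℕ) : Measurable (waitingTime π t) := by
  refine Measurable.iInf fun n => ?_
  exact (Measurable.of_discrete (f := fun s : State => ⨅ (_ : π s ≠ .wait), (n : ENNReal))).comp
    (measurable_chain π (t + n))

theorem ae_frequently_ne_wait {α γ : unitInterval} {π : Policy} (hπ : IsAdmissible α γ π) :
    ∀ᵐ ω ∂(blocksLaw α γ), ∃ᶠ N in atTop, π (chain π ω N) ≠ .wait := by
  have h1 : ∀ᵐ ω ∂(blocksLaw α γ), ∀ t, waitingTime π t ω < ⊤ :=
    ae_all_iff.2 fun t => ae_lt_top (measurable_waitingTime π t) (hπ.finite_wait t).ne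
  filter_upwards [h1] with ω hω
  refine frequently_atTop.2 fun t => ?_
  obtain ⟨n, hn⟩ := iInf_lt_iff.1 (hω t)
  obtain ⟨hn', -⟩ := iInf_lt_iff.1 hn
  exact ⟨t + n, by omega, hn'⟩

/-! ### Fluctuations of the potential -/

namespace Unprofitable

variable {x y γ : ℝ}

theorem abs_potential_le (H : Unprofitable x y γ) {s : State} (hs : Reachable s) :
    |potential x y γ s| ≤ 2 * (s.a + s.h) := by
  have h1 := H.neg_le_stateValue s
  have h2 := H.stateValue_le hs
  have h3 : 0 ≤ y * s.h := mul_nonneg H.y_nonneg (Nat.cast_nonneg _)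
  have h4 : y * s.h ≤ 1 * s.h :=
    mul_le_mul_of_nonneg_right (by linarith [H.y_le, H.x_le]) (Nat.cast_nonneg _)
  have h5 : (0 : ℝ) ≤ s.a := Nat.cast_nonneg _
  unfold potential
  exact abs_le.2 ⟨by linarith, by linarith⟩

theorem neg_potential_le (H : Unprofitable x y γ) (s : State) : -potential x y γ s ≤ s.h := by
  have h1 := H.neg_le_stateValue s
  have h4 : y * s.h ≤ 1 * s.h :=
    mul_le_mul_of_nonneg_right (by linarith [H.y_le, H.x_le]) (Nat.cast_nonneg _)
  unfold potential
  linarith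

/-- The advantage over adopting at once is at most what the prophet gains, hence geometrically small
in the deficit. -/
theorem catchUp_add_le (H : Unprofitable x y γ) {a h : ℕ} (hah : a ≤ h) (hh : 1 ≤ h) :
    catchUp x a h + a ≤ 2 * h * (1 / 2 : ℝ) ^ (h + 1 - a) := by
  have hx := H.x_pos
  have hx1 := H.x_le
  have h1 := catchUp_le_prophetValue hx.le (by linarith) (a := a) (h := h) (by omega)
  have h2 : x ^ (h + 1 - a) ≤ (1 / 2 : ℝ) ^ (h + 1 - a) := pow_le_pow_left₀ hx.le hx1 _
  have ha : (a : ℝ) ≤ h := by exact_mod_cast hah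
  have hh' : (1 : ℝ) ≤ h := by exact_mod_cast hh
  have ha0 : (0 : ℝ) ≤ a := Nat.cast_nonneg _
  have h3 : ((h : ℝ) + 1 - a) * x / (1 - x) ≤ h + 1 - a := by
    rw [div_le_iff₀ (by linarith)]
    exact mul_le_mul_of_nonneg_left (by linarith) (by linarith)
  have h4 : 0 ≤ ((h : ℝ) + 1 - a) * x / (1 - x) :=
    div_nonneg (mul_nonneg (by linarith) hx.le) (by linarith)
  have h5 : x * (h + ((h : ℝ) + 1 - a) * x / (1 - x)) + a ≤ 2 * h := by nlinarith
  have h6 : 0 ≤ x * (h + ((h : ℝ) + 1 - a) * x / (1 - x)) + a := by positivity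
  have h7 := mul_le_mul h2 h5 h6 (by positivity)
  unfold prophetValue at h1
  linarith

/-- A policy may wait far behind, where `h` has no useful moment bound. But there every outcome of
reward plus potential is close to the same number `-(y * h)`, the reward of adopting, so the
martingale increments stay square integrable. Otherwise the lengths are bounded through `a`, and `0`
serves as centre. -/
theorem exists_deviation_le (H : Unprofitable x y γ) {s : State} (hs : Reachable s) {c : Action}
    (hc : Feasible s c) : ∃ m : ℝ, ∀ b, |((reward s c b).1 : ℝ) - y * (reward s c b).2
      + potential x y γ (step s c b) - m|
      ≤ if s.h ≤ s.a then 3 * (2 * (s.a : ℝ) + 1)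
        else 1 + 2 * s.h * (1 / 2 : ℝ) ^ (s.h - s.a) := by
  have hy := H.y_nonneg
  have hy1 : y ≤ 1 / 2 := H.y_le.trans H.x_le
  split_ifs with hah
  · refine ⟨0, fun b => ?_⟩
    have h1 := abs_le.1 (H.abs_potential_le (hs.step hc b))
    have h2 : (((step s c b).a + (step s c b).h : ℕ) : ℝ) ≤ ((s.a + s.h + 1 : ℕ) : ℝ) := by
      have := hs.2
      refine Nat.cast_le.2 ?_
      obtain ⟨a, h, f⟩ := s
      simp only [Feasible] at hah hc this
      cases c
      · cases b <;> simp [step, initial]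
      · cases b <;> simp [step] at hc ⊢ <;> omega
      · cases b <;> simp [step, race] <;> omega
      · cases f <;> cases b <;> simp [step, race, extend] <;> omega
    have h3 : ((reward s c b).1 : ℝ) ≤ ((s.h + 1 : ℕ) : ℝ) := by
      refine Nat.cast_le.2 ?_
      obtain ⟨a, h, f⟩ := s
      cases c
      · simp [reward]
      · simp [reward]
      · cases b <;> simp [reward, raceReward]
      · cases f <;> cases b <;> simp [reward, raceReward]
    have h4 : ((reward s c b).2 : ℝ) ≤ s.h := by
      refine Nat.cast_le.2 ?_
      obtain ⟨a, h, f⟩ := s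
      cases c
      · simp [reward]
      · simp [reward]
      · cases b <;> simp [reward, raceReward]
      · cases f <;> cases b <;> simp [reward, raceReward]
    have h5 : y * ((reward s c b).2 : ℝ) ≤ 1 * s.h :=
      mul_le_mul (by linarith) h4 (Nat.cast_nonneg _) (by norm_num)
    have h6 : 0 ≤ y * ((reward s c b).2 : ℝ) := by positivity
    have h7 : (s.h : ℝ) ≤ s.a := by exact_mod_cast hah
    have h8 : (0 : ℝ) ≤ (reward s c b).1 := Nat.cast_nonneg _
    push_cast at h2 h3
    rw [sub_zero]
    exact abs_le.2 ⟨by linarith, by linarith⟩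
  · refine ⟨-(y * s.h), fun b => ?_⟩
    obtain ⟨a, h, f⟩ := s
    simp only [not_le] at hah
    have hp : 0 ≤ 2 * (h : ℝ) * (1 / 2) ^ (h - a) := by positivity
    have h1 := neg_le_catchUp H.x_pos.le (by linarith [H.x_le]) hah.le
    cases c
    · have h10 : stateValue x y γ ⟨1, 0, .irrelevant⟩ = 0 := by
        rw [stateValue_of_lt (by norm_num)]; simp [leadValue]
      have h01 : stateValue x y γ ⟨0, 1, .irrelevant⟩ = 0 := by
        rw [stateValue_of_gt (by norm_num)]
        have := neg_le_catchUp H.x_pos.le (by linarith [H.x_le]) (a := 0) (h := 1) (by norm_num)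
        exact le_antisymm (H.catchUp_nonpos (by norm_num) le_rfl) (by simpa using this)
      have h6 : |y| ≤ 1 := by rw [abs_of_nonneg hy]; linarith
      refine le_trans ?_ (le_add_of_nonneg_right hp)
      cases b <;> simp [reward, step, initial, potential, h10, h01, h6]
    · simp only [Feasible] at hc; omega
    · simp only [Feasible] at hc; omega
    · have hatt : |stateValue x y γ ⟨a + 1, h, .irrelevant⟩ + (a + 1)|
          ≤ 1 + 2 * (h : ℝ) * (1 / 2) ^ (h - a) := by
        rw [stateValue_irrelevant hah]
        have h2 := H.catchUp_add_le (a := a + 1) (h := h) hah (by omega)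
        have h3 := neg_le_catchUp H.x_pos.le (by linarith [H.x_le]) (a := a + 1) (h := h) hah
        rw [show h + 1 - (a + 1) = h - a by omega] at h2
        push_cast at h2 h3
        exact abs_le.2 ⟨by linarith, by linarith⟩
      have hhon : |stateValue x y γ ⟨a, h + 1, .relevant⟩ + a - y|
          ≤ 1 + 2 * (h : ℝ) * (1 / 2) ^ (h - a) := by
        rw [stateValue_of_gt (by simp only; omega)]
        have h2 := H.catchUp_add_le (a := a) (h := h) hah.le (by omega)
        have h3 := H.catchUp_antitone hah.le
        have h4 : (1 / 2 : ℝ) ^ (h + 1 - a) ≤ (1 / 2) ^ (h - a) :=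
          pow_le_pow_of_le_one (by norm_num) (by norm_num) (by omega)
        have h5 := neg_le_catchUp H.x_pos.le (by linarith [H.x_le]) (a := a) (h := h + 1) (by omega)
        have h6 : 2 * (h : ℝ) * (1 / 2) ^ (h + 1 - a) ≤ 2 * h * (1 / 2) ^ (h - a) := by gcongr
        simp only
        exact abs_le.2 ⟨by linarith, by linarith⟩
      have e1 : ∀ f', f' = Fork.irrelevant ∨ f' = Fork.relevant →
          ∀ b, |((reward ⟨a, h, f'⟩ .wait b).1 : ℝ) - y * (reward ⟨a, h, f'⟩ .wait b).2
          + potential x y γ (step ⟨a, h, f'⟩ .wait b) - -(y * h)|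
          ≤ 1 + 2 * (h : ℝ) * (1 / 2) ^ (h - a) := by
        rintro f' hf' b
        have e2 : (reward ⟨a, h, f'⟩ .wait b) = (0, 0) := by rcases hf' with rfl | rfl <;> rfl
        have e3 : step ⟨a, h, f'⟩ .wait b = extend ⟨a, h, f'⟩ b := by
          rcases hf' with rfl | rfl <;> rfl
        rw [e2, e3]
        cases b
        · refine le_trans (le_of_eq (congrArg _ ?_)) hatt
          simp only [extend, potential]; push_cast; ring
        · refine le_trans (le_of_eq (congrArg _ ?_)) hhon
          simp only [extend, potential]; push_cast; ring
        · refine le_trans (le_of_eq (congrArg _ ?_)) hhon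
          simp only [extend, potential]; push_cast; ring
      cases f
      · exact e1 _ (Or.inl rfl) b
      · exact e1 _ (Or.inr rfl) b
      · have := hs.1 rfl
        simp only at this
        omega

end Unprofitable

/-! ### From the potential to the relative revenue -/

/-- The relative revenue in the first `N` steps. -/
noncomputable def ratio (π : Policy) (ω : ℕ → Block) (N : ℕ) : ℝ :=
  (∑ t ∈ Finset.Icc 1 N, ((rewardAt π ω t).1 : ℝ)) /
    ∑ t ∈ Finset.Icc 1 N, (((rewardAt π ω t).1 : ℝ) + ((rewardAt π ω t).2 : ℝ))

theorem ratio_nonneg (π : Policy) (ω : ℕ → Block) (N : ℕ) : 0 ≤ ratio π ω N :=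
  div_nonneg (Finset.sum_nonneg fun _ _ => Nat.cast_nonneg _)
    (Finset.sum_nonneg fun _ _ => by positivity)

theorem ratio_le_one (π : Policy) (ω : ℕ → Block) (N : ℕ) : ratio π ω N ≤ 1 := by
  refine div_le_one_of_le₀ (Finset.sum_le_sum fun _ _ => ?_)
    (Finset.sum_nonneg fun _ _ => by positivity)
  linarith [Nat.cast_nonneg (α := ℝ) (rewardAt π ω ‹_›).2]

theorem REV_eq (π : Policy) (α γ : unitInterval) :
    REV π α γ = ∫ ω, liminf (ratio π ω) atTop ∂(blocksLaw α γ) := rfl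

theorem REV_le_of_ae_le {π : Policy} {α γ : unitInterval} {c : ℝ}
    (h : ∀ᵐ ω ∂(blocksLaw α γ), liminf (ratio π ω) atTop ≤ c) : REV π α γ ≤ c := by
  rw [REV_eq]
  -- Only nonnegativity of the liminf is needed here, not its integrability.
  refine (integral_mono_of_nonneg (ae_of_all _ fun ω => ?_) (integrable_const c) h).trans (by simp)
  exact le_liminf_of_le (isCoboundedUnder_ge_of_le atTop (ratio_le_one π ω))
    (Eventually.of_forall (ratio_nonneg π ω))

theorem length_chain_le {π : Policy} (hπ : ∀ s, Feasible s (π s)) (ω : ℕ → Block) (N : ℕ) :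
    ∑ t ∈ Finset.Icc 1 N, isHonest (ω (t + 1)) ≤
      ∑ t ∈ Finset.Icc 1 N, (((rewardAt π ω t).1 : ℝ) + ((rewardAt π ω t).2 : ℝ))
        + (chain π ω (N + 1)).h := by
  have h1 := sum_Icc_sub (fun t => ((chain π ω t).h : ℝ)) N
  have h2 : ∑ t ∈ Finset.Icc 1 N, isHonest (ω (t + 1)) ≤ ∑ t ∈ Finset.Icc 1 N,
      ((((rewardAt π ω t).1 : ℝ) + ((rewardAt π ω t).2 : ℝ))
        + (((chain π ω (t + 1)).h : ℝ) - (chain π ω t).h)) := by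
    refine Finset.sum_le_sum fun t _ => ?_
    have := length_le (hπ (chain π ω t)) (ω (t + 1))
    simp only [rewardAt, chain]
    linarith
  rw [Finset.sum_add_distrib, h1] at h2
  have : (0 : ℝ) ≤ (chain π ω 1).h := Nat.cast_nonneg _
  linarith

namespace Unprofitable

variable {x y : ℝ} {γ α : unitInterval}

noncomputable def gain (x y γ : ℝ) (π : Policy) (s : State) (b : Block) : ℝ :=
  ((reward s (π s) b).1 : ℝ) - y * (reward s (π s) b).2 + potential x y γ (step s (π s) b)

theorem ae_tendsto_average_gain (H : Unprofitable x y γ) (hα : (α : ℝ) = y / (1 + y))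
    {π : Policy} (hπ : ∀ s, Feasible s (π s)) :
    ∀ᵐ ω ∂(blocksLaw α γ), Tendsto (fun N : ℕ => (∑ t ∈ Finset.Icc 1 N,
      (gain x y γ π (chain π ω t) (ω (t + 1)) - blockMean α γ (gain x y γ π (chain π ω t)))) / N)
      atTop (nhds 0) := by
  obtain ⟨C, hC0, hC⟩ := exists_sq_le_lyapunov
  have hy := H.y_nonneg
  have hy1 : y ≤ 1 / 2 := H.y_le.trans H.x_le
  refine ae_tendsto_average_chain α γ π _ (36 * C * 31) fun t => ?_
  have hi := (memLp_chain_block α γ π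
    (fun s b => gain x y γ π s b - blockMean α γ (gain x y γ π s)) t (t + 1) 2).integrable_sq
  have hi2 := ((integrable_const (1 : ℝ)).add (integrable_chain α γ π lyapunov t)).const_mul
    (36 * C)
  refine (integral_mono hi hi2 fun ω => ?_).trans ?_
  · have hs := reachable_chain hπ ω t
    set s := chain π ω t
    obtain ⟨m, hm⟩ := H.exists_deviation_le hs (hπ s)
    have h1 := abs_sub_blockMean_le α γ (f := gain x y γ π s) hm (ω (t + 1))
    have h2 := sq_le_sq' (by linarith [neg_abs_le (gain x y γ π s (ω (t + 1))
      - blockMean α γ (gain x y γ π s))]) ((le_abs_self _).trans h1)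
    refine h2.trans ?_
    have h3 := lyapunov_nonneg s
    simp only [Pi.add_apply]
    split_ifs with h4
    · have := (hC s).1 h4
      nlinarith
    · have := (hC s).2 (not_le.1 h4)
      nlinarith [mul_nonneg hC0 (by linarith : 0 ≤ 1 + lyapunov s)]
  · have h1 := integral_lyapunov_le α γ hy hy1 hα hπ t
    rw [integral_const_mul]
    simp only [Pi.add_apply]
    rw [integral_add (integrable_const _) (integrable_chain α γ π lyapunov t)]
    simp only [integral_const, probReal_univ, smul_eq_mul, mul_one]
    gcongr
    linarith

/-- The length of the honest chain if the attacker is not behind. -/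
def contested (s : State) : ℕ := if s.h ≤ s.a then s.h else 0

theorem ae_tendsto_contested (H : Unprofitable x y γ) (hα : (α : ℝ) = y / (1 + y))
    {π : Policy} (hπ : ∀ s, Feasible s (π s)) :
    ∀ᵐ ω ∂(blocksLaw α γ), Tendsto (fun N : ℕ => (contested (chain π ω N) : ℝ) / N)
      atTop (nhds 0) := by
  obtain ⟨C, hC0, hC⟩ := exists_sq_le_lyapunov
  have hy := H.y_nonneg
  have hy1 : y ≤ 1 / 2 := H.y_le.trans H.x_le
  have hle : ∀ s, (contested s : ℝ) ^ 2 ≤ C * lyapunov s := by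
    intro s
    unfold contested
    split_ifs with hs
    · refine le_trans ?_ ((hC s).1 hs)
      have : (s.h : ℝ) ≤ s.a := by exact_mod_cast hs
      have : (0 : ℝ) ≤ s.h := Nat.cast_nonneg _
      gcongr
      linarith
    · have := mul_nonneg hC0 (lyapunov_nonneg s)
      simpa using this
  have key := ae_tendsto_zero_of_integral_le (μ := blocksLaw α γ)
    (fun N ω => (contested (chain π ω N) : ℝ) ^ 2 / (N : ℝ) ^ 2) (fun N ω => by positivity)
    (fun N => integrable_chain α γ π (fun s => (contested s : ℝ) ^ 2 / (N : ℝ) ^ 2) N)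
    (fun N => C * 30 * (1 / (N : ℝ) ^ 2))
    ((Real.summable_one_div_nat_pow.2 (by norm_num)).mul_left _) fun N => ?_
  · filter_upwards [key] with ω hω
    have := hω.sqrt
    simp only [← div_pow, Real.sqrt_zero] at this
    refine this.congr fun N => ?_
    rw [Real.sqrt_sq (by positivity)]
  · rw [integral_div, mul_one_div]
    gcongr
    refine (integral_mono (integrable_chain α γ π (fun s => (contested s : ℝ) ^ 2) N)
      ((integrable_chain α γ π lyapunov N).const_mul C) fun ω => hle _).trans ?_
    rw [integral_const_mul]
    gcongr
    exact integral_lyapunov_le α γ hy hy1 hα hπ N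

/-- A liminf is bounded by the values at infinitely many times, so times with an action other than
`wait` suffice. There the honest chain is `o(N)`: hence the total reward is at least a fixed
multiple of `N`, the final potential is negligible, and the potential inequality bounds the
numerator. -/
theorem ae_liminf_ratio_le (H : Unprofitable x y γ) (hα : (α : ℝ) = y / (1 + y))
    {π : Policy} (hπ : IsAdmissible α γ π) :
    ∀ᵐ ω ∂(blocksLaw α γ), liminf (ratio π ω) atTop ≤ α := by
  have hy := H.y_nonneg
  have hy1 : y ≤ 1 / 2 := H.y_le.trans H.x_le
  have hα1 : (1 - (α : ℝ)) * (1 + y) = 1 := by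
    rw [hα]; field_simp; ring
  have hα2 : 0 < 1 - (α : ℝ) := pos_of_mul_pos_left (by rw [hα1]; norm_num) (by linarith)
  filter_upwards [H.ae_tendsto_average_gain hα hπ.feasible, H.ae_tendsto_contested hα hπ.feasible,
    ae_tendsto_average_isHonest α γ, ae_frequently_ne_wait hπ] with ω h1 h2 h3 h4
  refine le_of_forall_pos_le_add fun δ hδ => ?_
  refine liminf_le_of_frequently_le ?_ (isBoundedUnder_of ⟨0, ratio_nonneg π ω⟩)
  set M : ℕ → ℝ := fun N => ∑ t ∈ Finset.Icc 1 N,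
      (gain x y γ π (chain π ω t) (ω (t + 1)) - blockMean α γ (gain x y γ π (chain π ω t)))
  set K : ℕ → ℝ := fun N => ∑ t ∈ Finset.Icc 1 N, (isHonest (ω (t + 1)) - (1 - α))
  set c : ℝ := |potential x y γ (chain π ω 1)| + 1
  have h5 : Tendsto (fun N : ℕ => c / N) atTop (nhds 0) := tendsto_const_div_atTop_nhds_zero_nat c
  have h6 : ∀ᶠ N : ℕ in atTop, (M N + contested (chain π ω N) + c) / N < δ / 2 := by
    have := (h1.add h2).add h5
    simp only [← add_div, add_zero] at this
    exact this.eventually_lt_const (by linarith)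
  have h7 : ∀ᶠ N : ℕ in atTop, -((1 - (α : ℝ)) / 2)
      < (K N - contested (chain π ω N) - c) / N := by
    have := (h3.sub h2).sub h5
    simp only [← sub_div, sub_zero] at this
    exact this.eventually_const_lt (by linarith)
  refine (h4.and_eventually ((h6.and h7).and (eventually_gt_atTop 0))).mono ?_
  rintro N ⟨hw, ⟨hM, hK⟩, hN⟩
  have hN' : (0 : ℝ) < N := by exact_mod_cast hN
  rw [div_lt_iff₀ hN'] at hM
  rw [lt_div_iff₀ hN'] at hK
  have hlen : ((chain π ω (N + 1)).h : ℝ) ≤ 1 + contested (chain π ω N) := by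
    exact_mod_cast length_step_le (hπ.feasible _) hw (ω (N + 1))
  set A := ∑ t ∈ Finset.Icc 1 N, ((rewardAt π ω t).1 : ℝ) with hA
  set S := ∑ t ∈ Finset.Icc 1 N, (((rewardAt π ω t).1 : ℝ) + ((rewardAt π ω t).2 : ℝ)) with hS
  have hSK : (1 - (α : ℝ)) * N + K N ≤ S + (chain π ω (N + 1)).h := by
    refine le_trans (le_of_eq ?_) (length_chain_le hπ.feasible ω N)
    simp only [K, Finset.sum_sub_distrib, Finset.sum_const, Nat.card_Icc, nsmul_eq_mul,
      Nat.add_sub_cancel]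
    ring
  have hc : 1 ≤ c := by simp [c]
  have hS0 : (1 - (α : ℝ)) / 2 * N ≤ S := by linarith
  have hSpos : 0 < S := lt_of_lt_of_le (by positivity) hS0
  have hnum : (1 + y) * A - y * S ≤ M N + potential x y γ (chain π ω 1)
      - potential x y γ (chain π ω (N + 1)) := by
    have e1 := sum_Icc_sub (fun t => potential x y γ (chain π ω t)) N
    have e2 : (1 + y) * A - y * S
        + ∑ t ∈ Finset.Icc 1 N, (potential x y γ (chain π ω (t + 1)) - potential x y γ (chain π ω t))
        ≤ M N := by
      rw [hA, hS, Finset.mul_sum, Finset.mul_sum, ← Finset.sum_sub_distrib,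
        ← Finset.sum_add_distrib]
      refine Finset.sum_le_sum fun t _ => ?_
      have e3 := H.mean_reward_add_potential_le (reachable_chain hπ.feasible ω t)
        (hπ.feasible (chain π ω t))
      rw [← hα] at e3
      change blockMean α γ (gain x y γ π (chain π ω t)) ≤ _ at e3
      simp only [gain, rewardAt, chain] at e3 ⊢
      linarith
    rw [e1] at e2
    linarith
  have hpot := H.neg_potential_le (chain π ω (N + 1))
  have hpot1 := le_abs_self (potential x y γ (chain π ω 1))
  have hfin : (1 + y) * A - y * S ≤ δ / 2 * N := by
    have : c = |potential x y γ (chain π ω 1)| + 1 := rfl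
    linarith
  change A / S ≤ α + δ
  rw [div_le_iff₀ hSpos]
  have e4 : δ * ((1 - (α : ℝ)) / 2 * N) ≤ δ * S := mul_le_mul_of_nonneg_left hS0 hδ.le
  have e5 : (1 - (α : ℝ)) * ((1 + y) * A - y * S) ≤ (1 - (α : ℝ)) * (δ / 2 * N) :=
    mul_le_mul_of_nonneg_left hfin hα2.le
  -- Since `(1 + y) * A - y * S` is the sum of `r¹ - y r²`, this converts the linear criterion back
  -- into the ratio.
  have e6 : (1 - (α : ℝ)) * ((1 + y) * A - y * S) = A - α * S := by
    linear_combination (A - S) * hα1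
  linarith

theorem REV_le (H : Unprofitable x y γ) (hα : (α : ℝ) = y / (1 + y))
    {π : Policy} (hπ : IsAdmissible α γ π) : REV π α γ ≤ α :=
  REV_le_of_ae_le (H.ae_liminf_ratio_le hα hπ)

end Unprofitable

/-! ### The revenue of honest mining -/

/-- Under honest mining the lengths depend on the last block alone, so every step settles exactly
that block for its creator. -/
theorem chain_honest (ω : ℕ → Block) (t : ℕ) :
    (ω t = .attacker → (chain honest ω t).a = 1 ∧ (chain honest ω t).h = 0) ∧
    (ω t ≠ .attacker → (chain honest ω t).a = 0 ∧ (chain honest ω t).h = 1) := by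
  induction t with
  | zero => cases h : ω 0 <;> simp [chain, initial, h]
  | succ t ih =>
    by_cases ht : ω t = .attacker
    · obtain ⟨h1, h2⟩ := ih.1 ht
      have : honest (chain honest ω t) = .override := by simp [honest, h1, h2]
      cases h : ω (t + 1) <;> simp [chain, this, step, h, h1, h2]
    · obtain ⟨h1, h2⟩ := ih.2 ht
      have : honest (chain honest ω t) = .adopt := by simp [honest, h1, h2]
      cases h : ω (t + 1) <;> simp [chain, this, step, initial, h]

theorem honest_ne_wait (ω : ℕ → Block) (t : ℕ) : honest (chain honest ω t) ≠ .wait := by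
  by_cases ht : ω t = .attacker
  · obtain ⟨h1, h2⟩ := (chain_honest ω t).1 ht
    simp [honest, h1, h2]
  · obtain ⟨h1, h2⟩ := (chain_honest ω t).2 ht
    simp [honest, h1, h2]

theorem rewardAt_honest (ω : ℕ → Block) (t : ℕ) :
    ((rewardAt honest ω t).1 : ℝ) = 1 - isHonest (ω t) ∧
      ((rewardAt honest ω t).2 : ℝ) = isHonest (ω t) := by
  cases ht : ω t
  · obtain ⟨h1, h2⟩ := (chain_honest ω t).1 ht
    have : honest (chain honest ω t) = .override := by simp [honest, h1, h2]
    simp [rewardAt, reward, this, h2, isHonest]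
  all_goals
    obtain ⟨h1, h2⟩ := (chain_honest ω t).2 (by rw [ht]; simp)
    have : honest (chain honest ω t) = .adopt := by simp [honest, h1, h2]
    simp [rewardAt, reward, this, h2, isHonest]

theorem isAdmissible_honest (α γ : unitInterval) : IsAdmissible α γ honest := by
  refine ⟨fun s => ?_, fun t => ?_⟩
  · unfold honest
    split_ifs with h1 h2
    · trivial
    · exact h2
    · trivial
  · have : ∀ ω, waitingTime honest t ω = 0 := fun ω =>
      le_antisymm (iInf₂_le_of_le 0 (honest_ne_wait ω (t + 0)) (by simp)) zero_le
    simp [this]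

theorem ae_tendsto_ratio_honest (α γ : unitInterval) :
    ∀ᵐ ω ∂(blocksLaw α γ), Tendsto (ratio honest ω) atTop (nhds α) := by
  filter_upwards [ae_tendsto_average_isHonest α γ] with ω hω
  have h1 : Tendsto (fun N : ℕ => (isHonest (ω (N + 1)) - isHonest (ω 1)) / N) atTop (nhds 0) := by
    refine squeeze_zero_norm (fun N => ?_) (tendsto_const_div_atTop_nhds_zero_nat 2)
    rw [Real.norm_eq_abs, abs_div, Nat.abs_cast]
    gcongr
    have := abs_isHonest_le (ω (N + 1))
    have := abs_isHonest_le (ω 1)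
    exact (abs_sub _ _).trans (by linarith)
  have h2 := (h1.sub hω).const_add (α : ℝ)
  simp only [sub_zero, add_zero] at h2
  refine h2.congr' ?_
  filter_upwards [eventually_gt_atTop 0] with N hN
  have hN' : (N : ℝ) ≠ 0 := by positivity
  have e1 : ∀ t, ((rewardAt honest ω t).1 : ℝ) + ((rewardAt honest ω t).2 : ℝ) = 1 := fun t => by
    rw [(rewardAt_honest ω t).1, (rewardAt_honest ω t).2]; ring
  have e2 := sum_Icc_sub (fun t => isHonest (ω t)) N
  simp only [Finset.sum_sub_distrib] at e2
  simp only [ratio, e1]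
  simp only [(rewardAt_honest ω _).1, Finset.sum_sub_distrib, Finset.sum_const,
    Nat.card_Icc, Nat.add_sub_cancel, nsmul_eq_mul, mul_one]
  rw [← e2]
  field_simp
  ring

theorem REV_honest (α γ : unitInterval) : REV honest α γ = α := by
  rw [REV_eq, integral_congr_ae (g := fun _ => (α : ℝ))]
  · simp
  · filter_upwards [ae_tendsto_ratio_honest α γ] with ω hω
    exact hω.liminf_eq

/-! ### Climbing probabilities and the compensation -/

/-- The probability that a walk with odds `x : 1` makes `m` steps up before it is `k` below its
start. -/
noncomputable def climbProb (x : ℝ) : ℕ → ℕ → ℝ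
  | 0, _ => 1
  | _ + 1, 0 => 0
  | m + 1, k + 1 => (x * climbProb x m (k + 2) + climbProb x (m + 1) k) / (1 + x)

theorem climbProb_zero (x : ℝ) (k : ℕ) : climbProb x 0 k = 1 := by simp [climbProb]

theorem climbProb_succ_zero (x : ℝ) (m : ℕ) : climbProb x (m + 1) 0 = 0 := by simp [climbProb]

theorem climbProb_succ_succ {x : ℝ} (hx : 0 ≤ x) (m k : ℕ) :
    (1 + x) * climbProb x (m + 1) (k + 1) = x * climbProb x m (k + 2) + climbProb x (m + 1) k := by
  rw [climbProb]
  have : 1 + x ≠ 0 := by linarith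
  field_simp

theorem climbProb_nonneg {x : ℝ} (hx : 0 ≤ x) (m k : ℕ) : 0 ≤ climbProb x m k := by
  induction m generalizing k with
  | zero => simp [climbProb_zero]
  | succ m ih =>
    induction k with
    | zero => simp [climbProb_succ_zero]
    | succ k ihk =>
      rw [climbProb]
      have := ih (k + 2)
      positivity

theorem climbProb_le_one {x : ℝ} (hx : 0 ≤ x) (m k : ℕ) : climbProb x m k ≤ 1 := by
  induction m generalizing k with
  | zero => simp [climbProb_zero]
  | succ m ih =>
    induction k with
    | zero => simp [climbProb_succ_zero]
    | succ k ihk =>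
      rw [climbProb, div_le_one (by linarith)]
      have := mul_le_mul_of_nonneg_left (ih (k + 2)) hx
      linarith

theorem climbProb_antitone {x : ℝ} (hx : 0 ≤ x) (m k : ℕ) :
    climbProb x (m + 1) k ≤ climbProb x m k := by
  induction m generalizing k with
  | zero => rw [climbProb_zero]; exact climbProb_le_one hx 1 k
  | succ m ih =>
    induction k with
    | zero => simp [climbProb_succ_zero]
    | succ k ihk =>
      have h1 := climbProb_succ_succ hx m k
      have h2 := climbProb_succ_succ hx (m + 1) k
      have h3 := mul_le_mul_of_nonneg_left (ih (k + 2)) hx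
      refine le_of_mul_le_mul_left ?_ (by linarith : 0 < 1 + x)
      linarith

/-- This compares the truncation loss behind, started at `(1, 2)`, with the truncation bonus ahead,
started at `(2, 0)`. -/
theorem mul_climbProb_two_le {x : ℝ} (hx : 0 ≤ x) (m : ℕ) :
    x * climbProb x m 2 ≤ (1 + x) * climbProb x m 1 := by
  cases m with
  | zero => simp [climbProb_zero]
  | succ m =>
    rw [climbProb_succ_succ hx, climbProb_succ_zero, add_zero]
    exact mul_le_mul_of_nonneg_left (climbProb_antitone hx m 2) hx

theorem compensation_of_le {x : ℝ} (hx : 0 ≤ x) (hx1 : x < 1) {s : State} (hs : s.h ≤ s.a) :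
    (1 + x) * compensation (x / (1 + x)) (x / (1 + x)) s
      = x / (1 - x) ^ 2 + (1 + x) * (s.h + ((s.a : ℝ) - s.h) / (1 - x)) := by
  have h1 : 1 + x ≠ 0 := by linarith
  have h2 : 1 - x ≠ 0 := by linarith
  have e1 : 1 - 2 * (x / (1 + x)) = (1 - x) / (1 + x) := by field_simp; ring
  have e2 : 1 - x / (1 + x) = 1 / (1 + x) := by field_simp; ring
  rw [compensation, if_pos hs, e1, e2]
  field_simp
  ring

theorem compensation_of_lt {x : ℝ} (hx : 0 ≤ x) (hx1 : x < 1) {s : State} (hs : s.a < s.h) :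
    (1 + x) * compensation (x / (1 + x)) (x / (1 + x)) s
      = -(x * s.h) + x ^ (s.h - s.a) * (x * s.h + x / (1 - x) ^ 2
        + ((s.h : ℝ) - s.a) * ((1 + x) / (1 - x))) := by
  have h1 : 1 + x ≠ 0 := by linarith
  have h2 : 1 - x ≠ 0 := by linarith
  have e1 : 1 - 2 * (x / (1 + x)) = (1 - x) / (1 + x) := by field_simp; ring
  have e2 : 1 - x / (1 + x) = 1 / (1 + x) := by field_simp; ring
  have e3 : x / (1 + x) / (1 / (1 + x)) = x := by field_simp
  rw [compensation, if_neg hs.not_ge, e1, e2, e3]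
  field_simp
  ring

/-! ### A withholding policy in the over-paying process -/

open Classical in
/-- Withhold the first block and, while ahead by two or more, every further one; override at a lead
of one, match at the first tie and, when behind, wait in the states in `W`. -/
noncomputable def withholding (T : ℕ) (W : ℕ → ℕ → Prop) : Policy := fun s =>
  if T ≤ max s.a s.h then .adopt
  else if s.h < s.a then (if s.a = s.h + 1 ∧ s.h ≠ 0 then .override else .wait)
  else if s.a = 0 then .adopt
  else if s.a = 1 ∧ s.h = 1 ∧ s.fork = .relevant then .matching
  else if W s.a s.h then .wait else .adopt

theorem isTruncated_withholding (T : ℕ) (W : ℕ → ℕ → Prop) : IsTruncated T (withholding T W) := by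
  refine ⟨fun s => ?_, fun s hs => by simp [withholding, hs.ge]⟩
  unfold withholding
  split_ifs <;> simp_all [Feasible]

theorem withholding_one_zero {T : ℕ} (hT : 2 ≤ T) (W : ℕ → ℕ → Prop) (f : Fork) :
    withholding T W ⟨1, 0, f⟩ ≠ .override := by
  simp [withholding, show ¬ T ≤ 1 by omega]

/-- The states visited by `withholding T W`. -/
def Visited (T : ℕ) (s : State) : Prop :=
  (s.fork = .active → s.a = s.h + 1 ∧ 1 ≤ s.h) ∧ 1 ≤ s.a + s.h ∧ s.a ≤ T ∧ s.h ≤ T ∧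
    (s.a < T ∨ s.h < T)

theorem visited_initial {T : ℕ} (hT : 2 ≤ T) (b : Block) : Visited T (initial b) := by
  cases b <;> simp [Visited, initial] <;> omega

theorem Visited.step {T : ℕ} (hT : 2 ≤ T) (W : ℕ → ℕ → Prop) {s : State} (hs : Visited T s)
    (b : Block) : Visited T (step s (withholding T W s) b) := by
  obtain ⟨h1, h2, h3, h4, h5⟩ := hs
  unfold withholding
  have hextend : ¬ T ≤ max s.a s.h → (s.fork ≠ .active) → Visited T (SelfishMining.step s .wait b) := by
    intro hm hf
    obtain ⟨a, h, f⟩ := s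
    simp only at *
    rw [max_def] at hm
    split_ifs at hm <;> cases f <;> cases b <;>
      simp [Visited, SelfishMining.step, extend] at hf ⊢ <;> omega
  split_ifs with c1 c2 c3 c4 c5 c6
  · exact visited_initial hT b
  · obtain ⟨a, h, f⟩ := s
    obtain ⟨(c3 : a = h + 1), c4⟩ := c3
    subst c3
    cases b <;> simp [Visited, SelfishMining.step] <;> omega
  · refine hextend c1 fun hf => c3 ?_
    have := h1 hf
    omega
  · exact visited_initial hT b
  · obtain ⟨a, h, f⟩ := s
    obtain ⟨rfl, rfl, rfl⟩ := c5
    cases b <;> simp [Visited, SelfishMining.step, race] <;> omega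
  · refine hextend c1 fun hf => c2 ?_
    have := h1 hf
    omega
  · exact visited_initial hT b

theorem visited_chain {T : ℕ} (hT : 2 ≤ T) (W : ℕ → ℕ → Prop) (ω : ℕ → Block) (t : ℕ) :
    Visited T (chain (withholding T W) ω t) := by
  induction t with
  | zero => exact visited_initial hT _
  | succ t ih => exact ih.step hT W _

/-- Values `g` of the states in which the attacker is not ahead, for which waiting exactly in the
states in `W` makes withholding the first block profitable in the over-paying process. -/
structure Profitable (x γ : ℝ) (T : ℕ) (W : ℕ → ℕ → Prop) (g : ℕ → ℕ → ℝ) : Prop where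
  x_pos : 0 < x
  x_lt : x < 1
  γ_nonneg : 0 ≤ γ
  γ_le : γ ≤ 1
  T_le : 2 ≤ T
  wait : ∀ a h, 1 ≤ a → a ≤ h → h < T → W a h → (1 + x) * g a h ≤ x * g (a + 1) h + g a (h + 1)
  adopt : ∀ a h, a ≤ h → ¬ W a h → g a h ≤ -a
  override : ∀ h, g (h + 1) h ≤ x * h
  truncate : ∀ a, a < T → g a T ≤ -a + x ^ (T - a) * (x * T + x / (1 - x) ^ 2
    + ((T : ℝ) - a) * ((1 + x) / (1 - x)))
  withhold : 0 ≤ x * (1 + x) * (x / (1 - x) + x * T * climbProb x (T - 2) 1)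
    + (x + γ) * x + (1 - γ) * g 1 2

namespace Profitable

variable {x γ : ℝ} {T : ℕ} {W : ℕ → ℕ → Prop} {g : ℕ → ℕ → ℝ}

-- With a lead, `leadValue` is increased by a bonus `x * T`, collected if the attacker's chain
-- reaches `T` before the lead falls to one. Both terms are harmonic for waiting.
open Classical in
noncomputable def value (x γ : ℝ) (T : ℕ) (g : ℕ → ℕ → ℝ) (s : State) : ℝ :=
  if s.h < s.a then leadValue x s.a s.h + x * T * climbProb x (T - s.a) (s.a - s.h - 1)
  else if s.a = 0 then 0
  else if s.a = 1 ∧ s.h = 1 ∧ s.fork = .relevant then ((x + γ) * x + (1 - γ) * g 1 2) / (1 + x)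
  else g s.a s.h

noncomputable def pot (x γ : ℝ) (T : ℕ) (g : ℕ → ℕ → ℝ) (s : State) : ℝ :=
  value x γ T g s + s.a - x * s.h

theorem value_override (H : Profitable x γ T W g) {h : ℕ} (f : Fork) :
    x * h ≤ value x γ T g ⟨h + 1, h, f⟩ := by
  have := mul_nonneg (mul_nonneg H.x_pos.le (Nat.cast_nonneg (α := ℝ) T))
    (climbProb_nonneg H.x_pos.le (T - (h + 1)) 0)
  simp [value, leadValue]
  linarith

theorem value_override_eq {h : ℕ} (hT : h + 1 < T) (f : Fork) :
    value x γ T g ⟨h + 1, h, f⟩ = x * h := by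
  obtain ⟨m, rfl⟩ := Nat.exists_eq_add_of_lt hT
  have : h + 1 + m + 1 - (h + 1) = m + 1 := by omega
  simp [value, leadValue, this, climbProb_succ_zero]

theorem value_zero (h : ℕ) (f : Fork) : value x γ T g ⟨0, h, f⟩ = 0 := by simp [value]

theorem mean_initial (H : Profitable x γ T W g) (r : ℝ) :
    blockMean (x / (1 + x)) γ (fun b => r + pot x γ T g (initial b)) = r := by
  have h1 : value x γ T g ⟨1, 0, .irrelevant⟩ = 0 := by
    simpa using value_override_eq (x := x) (γ := γ) (g := g) (h := 0) (T := T)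
      (by have := H.T_le; omega) .irrelevant
  have h2 : 1 + x ≠ 0 := by linarith [H.x_pos]
  rw [blockMean_eq_div H.x_pos.le, div_eq_iff h2]
  simp only [initial, pot, h1, value_zero]
  push_cast
  ring

theorem overReward_of_ne (hx : 0 ≤ x) {s : State} (hs : max s.a s.h ≠ T) (c : Action) (b : Block) :
    (1 + x) * overReward (x / (1 + x)) (x / (1 + x)) T s c b
      = ((reward s c b).1 : ℝ) - x * (reward s c b).2 := by
  have : 1 + x ≠ 0 := by linarith
  rw [overReward, if_neg hs, w]
  field_simp
  ring

/-- For `T = a` the compensation exceeds the value of the lead by enough to cover the bonus `x * T`.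
For `T = h` the claim is the field `truncate`. -/
theorem pot_le_compensation (H : Profitable x γ T W g) {s : State} (hs : Visited T s)
    (hm : max s.a s.h = T) :
    pot x γ T g s ≤ (1 + x) * compensation (x / (1 + x)) (x / (1 + x)) s := by
  obtain ⟨a, h, f⟩ := s
  obtain ⟨-, h2, h3, h4, h5⟩ := hs
  have hx := H.x_pos
  have hx1 := H.x_lt
  have hT := H.T_le
  have h1x : 0 < 1 - x := by linarith
  simp only at *
  rcases Nat.lt_or_ge h a with hah | hah
  · obtain rfl : a = T := by rw [← hm, max_eq_left hah.le]
    rw [compensation_of_le hx.le hx1 hah.le]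
    have hc := climbProb_le_one hx.le (a - a) (a - h - 1)
    have e1 : ((a : ℝ) - h - 1) * (1 - x)⁻¹ = ((a : ℝ) - h) / (1 - x) - 1 / (1 - x) := by
      field_simp
    have e2 : (a : ℝ) - h ≤ ((a : ℝ) - h) / (1 - x) := by
      have : (h : ℝ) ≤ a := by exact_mod_cast hah.le
      rw [le_div_iff₀ h1x]
      nlinarith
    have e3 : 0 ≤ x / (1 - x) ^ 2 := by positivity
    have e4 : 0 ≤ x * (1 / (1 - x)) := by positivity
    have e5 : x * a * climbProb x (a - a) (a - h - 1) ≤ x * a * 1 := by gcongr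
    have e6 : ((a : ℝ) - h) / (1 - x) * (1 - x) = a - h := by field_simp
    simp only [pot, value, hah, if_true, leadValue]
    rw [e1]
    nlinarith [mul_le_mul_of_nonneg_left e2 hx.le]
  · have haT : a < T := by omega
    obtain rfl : h = T := by rw [← hm, max_eq_right hah]
    rw [compensation_of_lt hx.le hx1 haT]
    simp only
    have e1 : ¬ (a = 1 ∧ h = 1 ∧ f = Fork.relevant) := by omega
    have e2 : value x γ h g ⟨a, h, f⟩ ≤ -a + x ^ (h - a) * (x * h + x / (1 - x) ^ 2
        + ((h : ℝ) - a) * ((1 + x) / (1 - x))) := by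
      simp only [value, hah.not_gt, if_false, if_neg e1]
      split_ifs with h0
      · have : (a : ℝ) ≤ h := by exact_mod_cast hah
        have : 0 ≤ (h : ℝ) - a := by linarith
        subst h0
        push_cast
        rw [neg_zero, zero_add]
        push_cast at this
        positivity
      · exact H.truncate a haT
    simp only [pot]
    linarith

theorem pot_le_mean (H : Profitable x γ T W g) {s : State} (hs : Visited T s) :
    pot x γ T g s ≤ blockMean (x / (1 + x)) γ (fun b =>
      (1 + x) * overReward (x / (1 + x)) (x / (1 + x)) T s (withholding T W s) b
        + pot x γ T g (step s (withholding T W s) b)) := by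
  have hx := H.x_pos
  have hT := H.T_le
  by_cases hm : max s.a s.h = T
  · have h1 : withholding T W s = .adopt := by simp [withholding, hm]
    simp only [h1, overReward, hm, if_true, step]
    rw [H.mean_initial]
    exact H.pot_le_compensation hs hm
  simp only [overReward_of_ne hx.le hm]
  obtain ⟨a, h, f⟩ := s
  obtain ⟨h1, h2, h3, h4, h5⟩ := hs
  simp only at *
  have hlt : a < T ∧ h < T := by
    rcases le_total a h with h6 | h6
    · rw [max_eq_right h6] at hm; omega
    · rw [max_eq_left h6] at hm; omega
  obtain ⟨haT, hhT⟩ := hlt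
  have hnm : ¬ T ≤ max a h := by rw [le_max_iff]; omega
  have hadopt : ∀ h' : ℕ, value x γ T g ⟨a, h', f⟩ ≤ -a → pot x γ T g ⟨a, h', f⟩ ≤
      blockMean (x / (1 + x)) γ (fun b => ((reward ⟨a, h', f⟩ .adopt b).1 : ℝ)
        - x * (reward ⟨a, h', f⟩ .adopt b).2 + pot x γ T g (step ⟨a, h', f⟩ .adopt b)) := by
    intro h' hv
    simp only [reward, step]
    rw [H.mean_initial]
    simp only [pot]
    push_cast
    linarith
  have hwait : f ≠ .active → (1 + x) * value x γ T g ⟨a, h, f⟩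
      ≤ x * value x γ T g ⟨a + 1, h, .irrelevant⟩ + value x γ T g ⟨a, h + 1, .relevant⟩ →
      pot x γ T g ⟨a, h, f⟩ ≤
      blockMean (x / (1 + x)) γ (fun b => ((reward ⟨a, h, f⟩ .wait b).1 : ℝ)
        - x * (reward ⟨a, h, f⟩ .wait b).2 + pot x γ T g (step ⟨a, h, f⟩ .wait b)) := by
    intro hf hv
    rw [blockMean_eq_div hx.le, le_div_iff₀ (by linarith)]
    cases f
    · simp only [reward, step, extend, pot]
      push_cast
      linarith
    · simp only [reward, step, extend, pot]
      push_cast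
      linarith
    · exact absurd rfl hf
  rcases Nat.lt_or_ge h a with hah | hah
  · obtain ⟨d, rfl⟩ := Nat.exists_eq_add_of_lt hah
    rcases Nat.eq_zero_or_pos d with rfl | hd
    · rcases Nat.eq_zero_or_pos h with rfl | hh
      · have hp : withholding T W ⟨0 + 0 + 1, 0, f⟩ = .wait := by
          simp [withholding]; omega
        rw [hp]
        refine hwait (fun hf => by simpa using (h1 hf).2) ?_
        have e1 := value_override_eq (x := x) (γ := γ) (g := g) (h := 0) (T := T) haT f
        have e2 : value x γ T g ⟨2, 0, .irrelevant⟩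
            = x / (1 - x) + x * T * climbProb x (T - 2) 1 := by
          simp [value, leadValue]
          norm_num
          ring
        have e3 : value x γ T g ⟨1, 1, .relevant⟩
            = ((x + γ) * x + (1 - γ) * g 1 2) / (1 + x) := by simp [value]
        have e4 := H.withhold
        norm_num at e1 ⊢
        rw [e1, e2, e3, mul_zero, ← sub_le_iff_le_add', le_div_iff₀ (by linarith)]
        linarith
      · have hp : withholding T W ⟨h + 0 + 1, h, f⟩ = .override := by
          simp [withholding, hh.ne']; omega
        rw [hp, blockMean_eq_div hx.le, le_div_iff₀ (by linarith)]
        have e1 := value_override_eq (x := x) (γ := γ) (g := g) (h := h) (T := T) haT f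
        have e2 := value_override_eq (x := x) (γ := γ) (g := g) (h := 0) (T := T) (by omega)
          .irrelevant
        simp at e1 e2
        simp [reward, step, pot, e1, e2, value_zero]
        linarith
    · have hp : withholding T W ⟨h + d + 1, h, f⟩ = .wait := by
        simp only [withholding, if_neg hnm, if_pos hah,
          if_neg (show ¬ (h + d + 1 = h + 1 ∧ h ≠ 0) by omega)]
      rw [hp]
      refine hwait (fun hf => by have := (h1 hf).1; omega) ?_
      obtain ⟨d, rfl⟩ := Nat.exists_eq_add_of_le' hd
      obtain ⟨m, rfl⟩ := Nat.exists_eq_add_of_lt haT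
      have c1 : h < h + (d + 1) + 1 := by omega
      have c2 : h < h + (d + 1) + 1 + 1 := by omega
      have c3 : h + 1 < h + (d + 1) + 1 := by omega
      have i1 : h + (d + 1) + 1 + m + 1 - (h + (d + 1) + 1) = m + 1 := by omega
      have i2 : h + (d + 1) + 1 + m + 1 - (h + (d + 1) + 1 + 1) = m := by omega
      have j1 : h + (d + 1) + 1 - h - 1 = d + 1 := by omega
      have j2 : h + (d + 1) + 1 + 1 - h - 1 = d + 2 := by omega
      have j3 : h + (d + 1) + 1 - (h + 1) - 1 = d := by omega
      simp only [value, c1, c2, c3, if_true, i1, i2, j1, j2, j3]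
      have e1 := climbProb_succ_succ hx.le m d
      have e2 : x * leadValue x (h + (d + 1) + 1 + 1) h + leadValue x (h + (d + 1) + 1) (h + 1)
          = (1 + x) * leadValue x (h + (d + 1) + 1) h := by
        have : (1 - x)⁻¹ * (1 - x) = 1 := inv_mul_cancel₀ (by linarith [H.x_lt])
        unfold leadValue
        push_cast
        linear_combination -x * this
      have e3 : ∀ r : ℝ, r * ((1 + x) * climbProb x (m + 1) (d + 1))
          = r * (x * climbProb x m (d + 2) + climbProb x (m + 1) d) := fun r => by rw [e1]
      have e4 := e3 (x * ((h + (d + 1) + 1 + m + 1 : ℕ) : ℝ))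
      linarith
  · rcases Nat.eq_zero_or_pos a with rfl | ha
    · have hp : withholding T W ⟨0, h, f⟩ = .adopt := by
        simp [withholding]
      rw [hp]
      exact hadopt h (by simp [value_zero])
    have hfa : f ≠ .active := fun hf => by have := (h1 hf).1; omega
    by_cases ht : a = 1 ∧ h = 1 ∧ f = .relevant
    · obtain ⟨rfl, rfl, rfl⟩ := ht
      have hp : withholding T W ⟨1, 1, .relevant⟩ = .matching := by
        simp [withholding]; omega
      rw [hp, blockMean_eq_div hx.le, le_div_iff₀ (by linarith)]
      have e1 := H.value_override (h := 1) .active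
      have e2 : (1 + x) * value x γ T g ⟨1, 1, .relevant⟩ = (x + γ) * x + (1 - γ) * g 1 2 := by
        have : 1 + x ≠ 0 := by linarith
        simp [value]
        field_simp
      have e3 : value x γ T g ⟨1, 2, .relevant⟩ = g 1 2 := by simp [value]
      have e4 := mul_le_mul_of_nonneg_left e1 hx.le
      simp only [Nat.reduceAdd, Nat.cast_one, mul_one] at e4
      simp only [reward, raceReward, step, race, pot, Nat.sub_self, value_zero, Nat.reduceAdd, e3]
      push_cast
      linarith
    · have hvg : value x γ T g ⟨a, h, f⟩ = g a h := by
        simp only [value, hah.not_gt, if_false, ha.ne', if_neg ht]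
      by_cases hW : W a h
      · have hp : withholding T W ⟨a, h, f⟩ = .wait := by
          simp only [withholding, hnm, hah.not_gt, if_false, ha.ne', if_neg ht, hW, if_true]
        rw [hp]
        refine hwait hfa ?_
        have e1 : value x γ T g ⟨a, h + 1, .relevant⟩ = g a (h + 1) := by
          have : ¬ (a = 1 ∧ h + 1 = 1) := by omega
          have c : ¬ h + 1 < a := by omega
          simp [value, c, ha.ne']
          omega
        have e2 : g (a + 1) h ≤ value x γ T g ⟨a + 1, h, .irrelevant⟩ := by
          rcases hah.eq_or_lt with rfl | hah
          · exact (H.override a).trans (H.value_override _)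
          · have c : ¬ h < a + 1 := by omega
            simp [value, c]
        rw [hvg, e1]
        have e3 := H.wait a h ha hah hhT hW
        have e4 := mul_le_mul_of_nonneg_left e2 hx.le
        linarith
      · have hp : withholding T W ⟨a, h, f⟩ = .adopt := by
          simp only [withholding, hnm, hah.not_gt, if_false, ha.ne', if_neg ht, hW]
        rw [hp]
        exact hadopt h (by rw [hvg]; exact H.adopt a h hah hW)

end Profitable

namespace Profitable

variable {x : ℝ} {γ α : unitInterval} {T : ℕ} {W : ℕ → ℕ → Prop} {g : ℕ → ℕ → ℝ}

/-- The visited states are bounded, so the strong law applies to the rewards plus the potential, and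
the telescoping potential divided by `N` vanishes. The submartingale inequality then leaves a
nonnegative average. -/
theorem overValue_nonneg (H : Profitable x γ T W g) (hα : (α : ℝ) = x / (1 + x)) :
    0 ≤ overValue α γ α T (withholding T W) := by
  set π := withholding T W with hπ
  have hx0 : 0 < 1 + x := by linarith [H.x_pos]
  set f : State → Block → ℝ := fun s b => (1 + x) * overReward α α T s (π s) b
    + pot x γ T g (step s (π s) b) with hf
  have hfin := finite_setOf_le T T
  have hvis := visited_chain H.T_le W
  have hmem : ∀ ω t, chain π ω t ∈ {s : State | s.a ≤ T ∧ s.h ≤ T} :=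
    fun ω t => ⟨(hvis ω t).2.2.1, (hvis ω t).2.2.2.1⟩
  obtain ⟨B, hB⟩ := (hfin.image2 (fun s b => |f s b|) (Set.finite_univ (α := Block))).bddAbove
  obtain ⟨P, hP⟩ := (hfin.image (fun s => |pot x γ T g s|)).bddAbove
  obtain ⟨R, hR⟩ := (hfin.image2 (fun s b => |overReward α α T s (π s) b|)
    (Set.finite_univ (α := Block))).bddAbove
  have hB' : ∀ t ω b, |f (chain π ω t) b| ≤ B := fun t ω b => hB ⟨_, hmem ω t, b, trivial, rfl⟩
  have hP' : ∀ ω t, |pot x γ T g (chain π ω t)| ≤ P := fun ω t => hP ⟨_, hmem ω t, rfl⟩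
  have hR' : ∀ ω t b, |overReward α α T (chain π ω t) (π (chain π ω t)) b| ≤ R :=
    fun ω t b => hR ⟨_, hmem ω t, b, trivial, rfl⟩
  refine integral_nonneg_of_ae ?_
  filter_upwards [ae_tendsto_average_chain_of_bounded α γ π f B hB'] with ω hω
  set u : ℕ → ℝ := fun N => 1 / (N : ℝ) *
    ∑ t ∈ Finset.Icc 1 N, overReward α α T (chain π ω t) (π (chain π ω t)) (ω (t + 1)) with hu
  have hub : ∀ N, u N ≤ R := by
    intro N
    rcases Nat.eq_zero_or_pos N with rfl | hN
    · simpa [hu] using (abs_nonneg _).trans (hR' ω 0 .attacker)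
    have hN' : (0 : ℝ) < N := by exact_mod_cast hN
    have h1 : ∑ t ∈ Finset.Icc 1 N, overReward α α T (chain π ω t) (π (chain π ω t)) (ω (t + 1))
        ≤ (Finset.Icc 1 N).card • R :=
      Finset.sum_le_card_nsmul _ _ _ fun t _ => (le_abs_self _).trans (hR' ω t _)
    rw [Nat.card_Icc, Nat.add_sub_cancel, nsmul_eq_mul] at h1
    rw [hu]
    simp only
    rw [one_div, inv_mul_le_iff₀ hN']
    exact h1
  have hlow : Tendsto (fun N : ℕ => ((∑ t ∈ Finset.Icc 1 N, (f (chain π ω t) (ω (t + 1))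
      - blockMean α γ (f (chain π ω t)))) / N - 2 * P / N) / (1 + x)) atTop (nhds 0) := by
    have := (hω.sub (tendsto_const_div_atTop_nhds_zero_nat (2 * P))).div_const (1 + x)
    simpa using this
  have hle : ∀ N : ℕ, ((∑ t ∈ Finset.Icc 1 N, (f (chain π ω t) (ω (t + 1))
      - blockMean α γ (f (chain π ω t)))) / N - 2 * P / N) / (1 + x) ≤ u N := by
    intro N
    have e1 := sum_Icc_sub (fun t => pot x γ T g (chain π ω t)) N
    have e2 : ∑ t ∈ Finset.Icc 1 N, (f (chain π ω t) (ω (t + 1)) - blockMean α γ (f (chain π ω t)))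
        ≤ (1 + x) * ∑ t ∈ Finset.Icc 1 N,
          overReward α α T (chain π ω t) (π (chain π ω t)) (ω (t + 1))
          + ∑ t ∈ Finset.Icc 1 N, (pot x γ T g (chain π ω (t + 1)) - pot x γ T g (chain π ω t)) := by
      rw [Finset.mul_sum, ← Finset.sum_add_distrib]
      refine Finset.sum_le_sum fun t _ => ?_
      have e3 := H.pot_le_mean (hvis ω t)
      rw [← hα] at e3
      change _ ≤ blockMean α γ (f (chain π ω t)) at e3
      simp only [hf, chain] at e3 ⊢
      linarith
    rw [e1] at e2
    have e4 := abs_le.1 (hP' ω (N + 1))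
    have e5 := abs_le.1 (hP' ω 1)
    rw [div_le_iff₀ hx0, ← sub_div, hu]
    simp only
    rw [mul_comm (1 / (N : ℝ)), mul_one_div, div_mul_eq_mul_div]
    gcongr
    linarith
  have h0 := hlow.liminf_eq
  change (0 : ℝ) ≤ liminf u atTop
  rw [← h0]
  exact liminf_le_liminf (Eventually.of_forall hle) hlow.isBoundedUnder_ge
    (isCoboundedUnder_ge_of_le atTop hub)

end Profitable

/-! ### Profitability in the over-paying process -/

theorem overValue_neg {α γ : unitInterval} {T : ℕ} (h : optValueNoOverride α γ T < 0) {π : Policy}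
    (hπ : IsTruncated T π) (hπ' : ∀ f, π ⟨1, 0, f⟩ ≠ .override) : overValue α γ α T π < 0 := by
  have hb : BddAbove (overValue α γ α T '' {π | IsTruncated T π ∧ ∀ f, π ⟨1, 0, f⟩ ≠ .override}) := by
    -- The real supremum of an unbounded set is `0` by convention, so a negative supremum implies
    -- boundedness.
    by_contra hb
    rw [optValueNoOverride, Real.sSup_of_not_bddAbove hb] at h
    exact lt_irrefl _ h
  exact (le_csSup hb ⟨π, ⟨hπ, hπ'⟩, rfl⟩).trans_lt h

/-- A third of the computing power makes selfish mining profitable. -/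
theorem profitable_of_half_le {x γ : ℝ} (hx : 1 / 2 ≤ x) (hx1 : x < 1) (hγ : 0 ≤ γ) (hγ1 : γ ≤ 1)
    {T : ℕ} (hT : 2 ≤ T) : Profitable x γ T (fun _ _ => False) (fun a _ => -a) where
  x_pos := by linarith
  x_lt := hx1
  γ_nonneg := hγ
  γ_le := hγ1
  T_le := hT
  wait := by simp
  adopt := by simp
  override h := by
    have : 0 ≤ x * h := mul_nonneg (by linarith) (Nat.cast_nonneg _)
    push_cast
    have : (0 : ℝ) ≤ h := Nat.cast_nonneg _
    linarith
  truncate a ha := by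
    have : (a : ℝ) ≤ T := by exact_mod_cast ha.le
    have h1 : 0 ≤ (T : ℝ) - a := by linarith
    have h2 : 0 < 1 - x := by linarith
    have h3 : 0 < x := by linarith
    have : 0 ≤ x ^ (T - a) * (x * T + x / (1 - x) ^ 2 + ((T : ℝ) - a) * ((1 + x) / (1 - x))) := by
      positivity
    linarith
  withhold := by
    have hx0 : 0 < x := by linarith
    have h2 : 0 < 1 - x := by linarith
    have h1 := climbProb_nonneg hx0.le (T - 2) 1
    have h3 : 0 ≤ x * (1 + x) * (x * T * climbProb x (T - 2) 1) := by positivity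
    -- Up to the factor `1 + x` this reads `(1 - x) ^ 2 ≤ x ^ 2`, which is where the threshold `x =
    -- 1 / 2` comes from.
    have h4 : 1 - x ^ 2 ≤ x * (1 + x) * (x / (1 - x)) := by
      rw [← mul_div_assoc, le_div_iff₀ h2]
      nlinarith [mul_nonneg (by linarith : 0 ≤ 2 * x - 1) hx0.le]
    have h5 : 0 ≤ γ * x := by positivity
    push_cast
    nlinarith

/-- If withholding the first block pays in the real process and the attacker has less than a third
of the computing power, it pays in the over-paying process: by reflection, the truncation gives at
least as much to an attacker that is ahead as it may take from one that is behind. -/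
theorem profitable_of_lt {x γ : ℝ} (hx : 0 < x) (hx1 : x < 1) (hγ : 0 ≤ γ) (hγ1 : γ ≤ 1)
    {T : ℕ} (hT : 2 ≤ T)
    (hw : -((1 + x) * (x ^ 2 / (1 - x))) ≤ (x + γ) * x + (1 - γ) * catchUp x 1 2) :
    Profitable x γ T (fun a h => -(a : ℝ) < catchUp x a h)
      -- The subtracted term bounds the loss when the honest chain reaches `T` before the attacker
      -- gets ahead. The factor `x ^ (h + 1 - a)` is the harmonic function that inverts the odds of
      -- the walk, so honest blocks become the up-steps of odds `x : 1` in `climbProb`.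
      (fun a h => catchUp x a h - T * x ^ (h + 2 - a) * climbProb x (T - h) (h + 1 - a)) where
  x_pos := hx
  x_lt := hx1
  γ_nonneg := hγ
  γ_le := hγ1
  T_le := hT
  wait a h _ hah hhT hlt := by
    have h1 := catchUp_step_eq hx.le hx1 hah hlt
    obtain ⟨d, rfl⟩ := Nat.exists_eq_add_of_le hah
    obtain ⟨m, rfl⟩ := Nat.exists_eq_add_of_lt hhT
    have i1 : a + d + m + 1 - (a + d) = m + 1 := by omega
    have i2 : a + d + m + 1 - (a + d + 1) = m := by omega
    have j1 : a + d + 2 - a = d + 2 := by omega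
    have j2 : a + d + 1 - a = d + 1 := by omega
    have j3 : a + d + 2 - (a + 1) = d + 1 := by omega
    have j4 : a + d + 1 - (a + 1) = d := by omega
    have j5 : a + d + 1 + 2 - a = d + 3 := by omega
    simp only [i1, i2, j1, j2, j3, j4, j5]
    have h2 := climbProb_succ_succ hx.le m d
    refine le_of_eq ?_
    linear_combination -h1 - ((a + d + m + 1 : ℕ) : ℝ) * x ^ (d + 2) * h2
  adopt a h hah hlt := by
    have := climbProb_nonneg hx.le (T - h) (h + 1 - a)
    have : 0 ≤ T * x ^ (h + 2 - a) * climbProb x (T - h) (h + 1 - a) := by positivity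
    have := not_lt.1 hlt
    linarith
  override h := by
    have := climbProb_nonneg hx.le (T - h) (h + 1 - (h + 1))
    have : 0 ≤ T * x ^ (h + 2 - (h + 1)) * climbProb x (T - h) (h + 1 - (h + 1)) := by positivity
    rw [catchUp_of_lt (Nat.lt_succ_self h)]
    linarith
  truncate a haT := by
    have h1 := catchUp_le_prophetValue hx.le hx1 (a := a) (h := T) (by omega)
    obtain ⟨d, rfl⟩ := Nat.exists_eq_add_of_lt haT
    have j1 : a + d + 1 + 2 - a = d + 3 := by omega
    have j2 : a + d + 1 + 1 - a = d + 2 := by omega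
    have j3 : a + d + 1 - a = d + 1 := by omega
    have h1x : 0 < 1 - x := by linarith
    simp only [prophetValue, j2] at h1
    simp only [j1, j3, Nat.sub_self, climbProb_zero, mul_one]
    refine (sub_le_sub_right h1 _).trans ?_
    rw [add_sub_assoc]
    refine add_le_add le_rfl ?_
    have hp : 0 ≤ x ^ (d + 1) := by positivity
    -- The loss `T * x ^ (d + 3)` cancels the term of the prophet bound that is proportional to the
    -- length `T`; the compensation covers the rest.
    have e1 : x ^ (d + 2) * (x * (((a + d + 1 : ℕ) : ℝ) + (((a + d + 1 : ℕ) : ℝ) + 1 - a) * x / (1 - x)) + a)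
        - ((a + d + 1 : ℕ) : ℝ) * x ^ (d + 3)
        = x ^ (d + 1) * (x * (x * ((d + 2) * (x / (1 - x))) + a)) := by
      push_cast; ring
    rw [e1]
    refine mul_le_mul_of_nonneg_left ?_ hp
    push_cast
    set t := (1 - x)⁻¹ with ht
    have ht0 : 0 < t := inv_pos.2 h1x
    have ht1 : 1 ≤ t := (one_le_inv₀ h1x).2 (by linarith)
    have e2 : x / (1 - x) ^ 2 = x * t ^ 2 := by rw [ht]; field_simp
    have e3 : x / (1 - x) = x * t := by rw [ht]; field_simp
    have e4 : (1 + x) / (1 - x) = (1 + x) * t := by rw [ht]; field_simp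
    rw [e2, e3, e4]
    have hd : (0 : ℝ) ≤ d := Nat.cast_nonneg _
    have f1 : x * t ≤ x * t ^ 2 := mul_le_mul_of_nonneg_left (by nlinarith) hx.le
    have f2 : x ^ 3 ≤ x := by nlinarith [mul_pos hx hx]
    have f2' : x ^ 3 * t ≤ x * t := by gcongr
    have f3 : ((d : ℝ) + 1) * (x ^ 3 * t) ≤ ((d : ℝ) + 1) * ((1 + x) * t) := by
      gcongr; linarith
    have f4 : 0 ≤ x * ((d : ℝ) + 1) := by positivity
    nlinarith
  withhold := by
    obtain ⟨m, rfl⟩ := Nat.exists_eq_add_of_le' hT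
    -- The loss `(1 - γ) * T * x ^ 3 * climbProb x (T - 2) 2` must not exceed the bonus `T * x ^ 2 *
    -- (1 + x) * climbProb x (T - 2) 1`.
    have h1 := mul_climbProb_two_le hx.le m
    have h2 := climbProb_nonneg hx.le m 2
    have h4 : x * (1 + x) * (x / (1 - x)) = (1 + x) * (x ^ 2 / (1 - x)) := by ring
    have h5 : 0 ≤ ((m + 2 : ℕ) : ℝ) * x ^ 2 := by positivity
    have h6 := mul_le_mul_of_nonneg_left h1 h5
    have h7 : 0 ≤ γ * (((m + 2 : ℕ) : ℝ) * x ^ 3 * climbProb x m 2) := by positivity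
    simp only [Nat.add_sub_cancel, Nat.reduceAdd, Nat.reduceSub]
    rw [mul_add, h4]
    nlinarith

end SelfishMining

/-! ### The theorem -/

open SelfishMining in
theorem corollary1 (γ α : unitInterval) (hα0 : 0 < (α : ℝ)) (hα : (α : ℝ) < 1 / 2)
    (T : ℕ) (hT : 2 ≤ T) (ε : ℝ) (hε : 0 < ε) (u₁ u₂ : ℝ)
    (hu₁ : SelfishMining.IsSolverOutput (SelfishMining.optValueNoOverride α γ T) ε u₁)
    (hu₂ : SelfishMining.IsSolverOutput (SelfishMining.optValueNoAdopt α γ T) ε u₂)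
    (h₁ : u₁ ≤ -ε) (h₂ : u₂ ≤ -ε) :
    SelfishMining.IsOptimal SelfishMining.honest α γ ∧
      ((α : ℝ) : EReal) ≤ SelfishMining.profitThreshold γ := by
  have hopt : optValueNoOverride α γ T < 0 := by
    have := (abs_lt.1 hu₁).1
    linarith
  set x : ℝ := α / (1 - α) with hx
  have hα1 : 0 < 1 - (α : ℝ) := by linarith
  have hx0 : 0 < x := div_pos hα0 hα1
  have hx1 : x < 1 := by rw [hx, div_lt_one hα1]; linarith
  have odds : ∀ β : ℝ, β ≤ α → β = β / (1 - β) / (1 + β / (1 - β)) := by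
    intro β hβ
    have : 1 - β ≠ 0 := by linarith
    field_simp
    ring
  have hαx : (α : ℝ) = x / (1 + x) := odds α le_rfl
  have hno : ∀ W g, ¬ Profitable x γ T W g := fun W g H =>
    absurd (H.overValue_nonneg hαx) (not_le.2
      (overValue_neg hopt (isTruncated_withholding T W) (withholding_one_zero hT W)))
  have hhalf : x ≤ 1 / 2 := by
    by_contra! h
    exact hno _ _ (profitable_of_half_le h.le hx1 γ.2.1 γ.2.2 hT)
  have hw : (x + γ) * x + (1 - γ) * catchUp x 1 2 ≤ -((1 + x) * (x ^ 2 / (1 - x))) := by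
    by_contra! h
    exact hno _ _ (profitable_of_lt hx0 hx1 γ.2.1 γ.2.2 hT h.le)
  -- The inequality at the odds `x` of `α` is used for every `β ≤ α`, which gives optimality (`β =
  -- α`) and the threshold bound together.
  have key : ∀ β : unitInterval, (β : ℝ) ≤ α → ∀ π, IsAdmissible β γ π → REV π β γ ≤ β := by
    intro β hβ π hπ
    refine Unprofitable.REV_le (x := x) (y := β / (1 - β)) ?_ (odds β hβ) hπ
    exact ⟨div_nonneg β.2.1 (by linarith),
      div_le_div₀ hα0.le hβ hα1 (by linarith), hx0, hhalf, γ.2.1, γ.2.2, hw⟩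
  refine ⟨⟨isAdmissible_honest α γ, fun π hπ => ?_⟩, le_sInf ?_⟩
  · rw [REV_honest]
    exact key α le_rfl π hπ
  · rintro _ ⟨β, rfl, π, hπ, hlt⟩
    rw [REV_honest] at hlt
    rw [EReal.coe_le_coe_iff]
    by_contra! hβ
    exact absurd (key β hβ.le π hπ) (not_le.2 hlt)
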